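/- Let $\mathcal H$ be a real Hilbert space, $f:\mathcal H\to\mathbb R\cup\{+\infty\}$ proper, convex and lower semicontinuous, and $g,\psi:\mathcal H\to\mathbb R$ convex and Fréchet differentiable with Lipschitz continuous gradients, $\nabla\psi$ being $L_\psi$-Lipschitz with $L_\psi>0$, and $\min\psi=0$. Consider the bilevel problem $$\inf_{x\in\operatorname{argmin}\psi}\{f(x)+g(x)\}.\qquad(P)$$ Put $C=\operatorname{argmin}\psi=\operatorname{zer}\nabla\psi=\{x:\nabla\psi(x)=0\}$, let $N_C$ be its normal cone operator, $\operatorname{ran}N_C=\bigcup_xN_C(x)$, $\sigma_C(u)=\sup_{y\in C}\langle y,u\rangle$ its support function, $\psi^*(u)=\sup_{x}\{\langle u,x\rangle-\psi(x)\}$ the Fenchel conjugate of $\psi$, $\partial f$ the convex subdifferential of $f$, and $Z=\{x: 0\in\partial f(x)+\nabla g(x)+N_C(x)\}$. For $r>0$ let $\operatorname{prox}_{rf}(x)$ be the unique minimizer of $y\mapsto f(y)+\frac1{2r}\|y-x\|^2$. Let $\gamma,\lambda,\beta:[0,+\infty)\to(0,+\infty)$ be continuous and suppose that: - $\partial f+N_C$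 is maximally monotone and $Z\neq\emptyset$; - $\lambda\in L^2([0,+\infty))\setminus L^1([0,+\infty))$ and $\lim_{t\to+\infty}\lambda(t)=0$; - for every $p\in\operatorname{ran}N_C$, $\int_0^{+\infty}\lambda(t)\beta(t)\left[\psi^*\left(\frac{p}{\beta(t)}\right)-\sigma_C\left(\frac{p}{\beta(t)}\right)\right]dt<+\infty$; - $\limsup_{t\to+\infty}\lambda(t)\beta(t)<\frac1{L_\psi}$; - $\gamma$ is locally absolutely continuous, and $\gamma(t)\ge\sqrt2$ and $\dot\gamma(t)\le0$ for almost every $t\ge0$. Let $u_0,v_0\in\mathcal H$ and let $x:[0,+\infty)\to\mathcal H$ be the strong global solution of $$\ddot x(t)+\gamma(t)\dot x(t)+x(t)=\operatorname{prox}_{\lambda(t)f}\big(x(t)-\lambda(t)\nabla g(x(t))-\lambda(t)\beta(t)\nabla\psi(x(t))\big),\qquad x(0)=u_0,\ \dot x(0)=v_0,$$ that is, $x$ and $\dot x$ are absolutely continuous on each interval $[0,b]$, $0<b<+\infty$, the equation holds for almost every $t\ge0$, and the initial conditions hold. Let $\tilde x(t)=\frac{1}{\int_0^t\lambda(s)ds}\int_0^t\lambda(s)x(s)ds$.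 Then: (i) for every $x^*\in Z$, $\|x(t)-x^*\|$ converges as $t\to+\infty$, $\int_0^{+\infty}\lambda(t)\beta(t)\langle\nabla\psi(x(t)),x(t)-x^*\rangle dt<+\infty$ (the integrand is nonnegative), and $\lim_{t\to+\infty}\dot h(t)=0$, where $h(t)=\frac12\|x(t)-x^*\|^2$; moreover $\dot x,\ddot x\in L^2([0,+\infty),\mathcal H)$, $\lambda(\cdot)\beta(\cdot)\|\nabla\psi(x(\cdot))\|^2\in L^1([0,+\infty))$ and $\lim_{t\to+\infty}\dot x(t)=0$; (ii) $\tilde x(t)$ converges weakly as $t\to+\infty$ to an element of $Z$, which is also an optimal solution of $(P)$; (iii) if, additionally, $f$ is strongly convex, then $Z$ consists of exactly one element, which is also the unique optimal solution of $(P)$, and $x(t)$ converges strongly to it as $t\to+\infty$. -/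

import Mathlib

open Set Filter Topology MeasureTheory
open scoped NNReal ENNReal InnerProductSpace

namespace Bilevel

section Operators

variable {H : Type*} [NormedAddCommGroup H] [InnerProductSpace ℝ H]

/-- The set of zeros of a set-valued operator. -/
def zer (A : H → Set H) : Set H := {x | (0 : H) ∈ A x}

/-- The range of a set-valued operator. -/
def ran (A : H → Set H) : Set H := {u | ∃ x, u ∈ A x}

/-- The (pointwise Minkowski) sum of two set-valued operators. -/
def opAdd (A B : H → Set H) : H → Set H := fun x => {w | ∃ u ∈ A x, ∃ v ∈ B x, w = u + v}

/-- A single-valued operator regarded as a set-valued one. -/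
def singleValued (D : H → H) : H → Set H := fun x => {D x}

/-- Monotonicity of a set-valued operator. -/
def IsMonotoneOp (A : H → Set H) : Prop :=
  ∀ x y u v : H, u ∈ A x → v ∈ A y → 0 ≤ ⟪x - y, u - v⟫_ℝ

/-- Maximal monotonicity: there is no proper monotone extension of the graph. -/
def IsMaximallyMonotone (A : H → Set H) : Prop :=
  IsMonotoneOp A ∧ ∀ B : H → Set H, IsMonotoneOp B → (∀ x, A x ⊆ B x) → ∀ x, B x = A x

/-- The normal cone operator `N_S`; its value is empty outside `S`. -/
def normalCone (S : Set H) : H → Set H :=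
  fun x => {u | x ∈ S ∧ ∀ y ∈ S, ⟪y - x, u⟫_ℝ ≤ 0}

/-- The support function `σ_S`, extended-real-valued. -/
noncomputable def supportFun (S : Set H) (u : H) : EReal :=
  ⨆ y ∈ S, ((⟪y, u⟫_ℝ : ℝ) : EReal)

/-- The Fenchel conjugate of a real-valued function, extended-real-valued. -/
noncomputable def conjugate (ψ : H → ℝ) (u : H) : EReal :=
  ⨆ x : H, ((⟪u, x⟫_ℝ - ψ x : ℝ) : EReal)

/-- The set of global minimizers. -/
def argmin (ψ : H → ℝ) : Set H := {x | ∀ y, ψ x ≤ ψ y}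

/-- `f : H → ℝ ∪ {+∞}` is proper, convex and lower semicontinuous. -/
structure IsProperConvexLsc (f : H → EReal) : Prop where
  ne_bot : ∀ x, f x ≠ ⊥
  proper : ∃ x, f x ≠ ⊤
  convex : ∀ x y : H, ∀ a b : ℝ, 0 < a → 0 < b → a + b = 1 →
    f (a • x + b • y) ≤ (a : EReal) * f x + (b : EReal) * f y
  lsc : LowerSemicontinuous f

/-- Strong convexity of `f : H → ℝ ∪ {+∞}`, for some modulus `η > 0`. -/
def IsStronglyConvex (f : H → EReal) : Prop :=
  ∃ η : ℝ, 0 < η ∧ ∀ x y : H, ∀ a b : ℝ, 0 < a → 0 < b → a + b = 1 →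
    f (a • x + b • y) + ((a * b * (η / 2) * ‖x - y‖ ^ 2 : ℝ) : EReal) ≤
      (a : EReal) * f x + (b : EReal) * f y

/-- The convex subdifferential of `f : H → ℝ ∪ {+∞}`. -/
def subdiff (f : H → EReal) : H → Set H :=
  fun x => {u | ∀ y, f x + ((⟪u, y - x⟫_ℝ : ℝ) : EReal) ≤ f y}

/-- The set `argmin_y {f(y) + ‖y - x‖² / (2r)}`. For `r > 0` and `f` proper, convex and lower
semicontinuous on a Hilbert space it has exactly one element, the proximal point, so that
`p ∈ prox r f x` says that `p` is the proximal point. -/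
def prox (r : ℝ) (f : H → EReal) (x : H) : Set H :=
  {p | ∀ y, f p + ((1 / (2 * r) * ‖p - x‖ ^ 2 : ℝ) : EReal) ≤
    f y + ((1 / (2 * r) * ‖y - x‖ ^ 2 : ℝ) : EReal)}

/-- `x` is an optimal solution of the bilevel problem `inf_{x ∈ argmin ψ} f(x) + g(x)`. -/
def IsOptimalSolution (f : H → EReal) (g ψ : H → ℝ) (x : H) : Prop :=
  x ∈ argmin ψ ∧ ∀ y ∈ argmin ψ, f x + ((g x : ℝ) : EReal) ≤ f y + ((g y : ℝ) : EReal)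

end Operators

section Trajectories

/-- Local absolute continuity on `[0, +∞)`: absolute continuity on each `[0, b]`. -/
def LocallyAC {X : Type*} [PseudoMetricSpace X] (x : ℝ → X) : Prop :=
  ∀ b : ℝ, 0 < b → AbsolutelyContinuousOnInterval x 0 b

variable {H : Type*} [NormedAddCommGroup H] [InnerProductSpace ℝ H]

/-- The derivative of a trajectory on `[0, +∞)` (one-sided at `0`). -/
noncomputable def velocity (x : ℝ → H) : ℝ → H := derivWithin x (Ici 0)

/-- The second derivative of a trajectory on `[0, +∞)`. -/
noncomputable def acceleration (x : ℝ → H) : ℝ → H := derivWithin (velocity x) (Ici 0)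

/-- The ergodic average `(∫₀ᵗ lam)⁻¹ ∫₀ᵗ lam(s) x(s) ds`. -/
noncomputable def ergodicAverage (lam : ℝ → ℝ) (x : ℝ → H) (t : ℝ) : H :=
  (∫ s in (0 : ℝ)..t, lam s)⁻¹ • ∫ s in (0 : ℝ)..t, lam s • x s

variable [CompleteSpace H]

/-- The set-valued operator `∂f + ∇g + N_C` with `C = zer ∇ψ`. -/
def optimalityOp (f : H → EReal) (g ψ : H → ℝ) : H → Set H :=
  opAdd (opAdd (subdiff f) (singleValued (gradient g)))
    (normalCone (zer (singleValued (gradient ψ))))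

/-- Strong global solutions of
`x'' + γ(t) x' + x = prox_{lam(t) f} (x - lam(t) ∇g(x) - lam(t) β(t) ∇ψ(x))`,
`x(0) = u₀`, `x'(0) = v₀`. Only the values of the functions on `[0, +∞)` matter. -/
structure IsStrongGlobalSolution (f : H → EReal) (g ψ : H → ℝ) (γ lam β : ℝ → ℝ)
    (u₀ v₀ : H) (x : ℝ → H) : Prop where
  ac : LocallyAC x
  differentiable : DifferentiableOn ℝ x (Ici 0)
  ac_velocity : LocallyAC (velocity x)
  ode : ∀ᵐ t ∂(volume.restrict (Ici (0 : ℝ))),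
    DifferentiableWithinAt ℝ (velocity x) (Ici 0) t ∧
    acceleration x t + γ t • velocity x t + x t ∈
      prox (lam t) f
        (x t - lam t • gradient g (x t) - (lam t * β t) • gradient ψ (x t))
  init : x 0 = u₀
  init_velocity : velocity x 0 = v₀

end Trajectories

end Bilevel

/-! Write e = x'' + γ x' and X = x - u. The optimality condition of the proximal step reads -e/λ -
β∇ψ(x) - ∇g(x) ∈ ∂f(e + x). Testing it by monotonicity against v ∈ ∂f(u) and multiplying by λ bounds
‖e‖² + ⟪X, e⟫. The cross terms are absorbed by the cocoercivity of ∇ψ and ∇g (Baillon–Haddad,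
`cocoercive_gradient`) once λβLψ ≤ 1 and λLg ≤ 1/6; this leaves 7/12‖e‖² and part of λβ⟪∇ψ(x), X⟫
(`sq_norm_add_inner_le`).

The function `energy` is built so that, thanks to γ² ≥ 2 and γ' ≤ 0, its derivative is at most ⟪X,
e⟫ + 7/12‖e‖² minus multiples of ‖x''‖² and ‖x'‖². Hence, for every p ∈ N_C(u), energy' +
dissipation + λ⟪X, v + ∇g(u) + p⟫ ≤ remainder (`ae_deriv_energy_add_le`). The remainder is
integrable because λ ∈ L² and because, by the Fenchel inequality, ⟪X, p⟫ - βψ(x)/8 is at most β/8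
times the gap ψ* - σ_C at 8p/β (`integrableOn_penalty_gap`).

If v + ∇g(u) + p = 0, that is, u ∈ Z, the trajectory is bounded, the dissipation is integrable and
the energy converges. This yields (i), since x' → 0 and γ has a positive limit.

For general v and p the integrated inequality bounds ∫ λ⟪x - u, v + ∇g(u) + p⟫ from above. Division
by ∫ λ → ∞ shows that weak cluster points of the averages are monotonically related to the graph of
∂f + ∇g + N_C. Such points lie in Z (`mem_zer_of_forall_inner_nonneg`), and an Opial argument gives
(ii).

If f is strongly convex, the dissipation also controls λ‖e + X‖², so λ‖X‖² is integrable near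
infinity. As ‖X‖ converges and λ ∉ L¹, the limit is 0, which is (iii). -/

namespace Bilevel

/-! ### Subgradients, smooth convex functions and proximal points. -/

section ConvexAnalysis

variable {H : Type*} [NormedAddCommGroup H] [InnerProductSpace ℝ H]

/-- A finite extended real is real. -/
theorem exists_coe_eq {a : EReal} (hb : a ≠ ⊥) (ht : a ≠ ⊤) : ∃ r : ℝ, a = r :=
  ⟨a.toReal, (EReal.coe_toReal ht hb).symm⟩

theorem ne_top_of_mem_subdiff {f : H → EReal} (hf : IsProperConvexLsc f) {x u : H}
    (hu : u ∈ subdiff f x) : f x ≠ ⊤ := by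
  obtain ⟨y, hy⟩ := hf.proper
  intro h
  have := hu y
  rw [h, EReal.top_add_coe, top_le_iff] at this
  exact hy this

/-- The subgradient inequality between finite values. -/
theorem subdiff_real {f : H → EReal} {x y u : H} {a b : ℝ} (hu : u ∈ subdiff f x)
    (ha : f x = a) (hb : f y = b) : a + ⟪u, y - x⟫_ℝ ≤ b := by
  have := hu y
  rw [ha, hb] at this
  exact_mod_cast this

theorem isMonotoneOp_subdiff {f : H → EReal} (hf : IsProperConvexLsc f) :
    IsMonotoneOp (subdiff f) := by
  intro x y u v hu hv
  obtain ⟨a, ha⟩ := exists_coe_eq (hf.ne_bot x) (ne_top_of_mem_subdiff hf hu)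
  obtain ⟨b, hb⟩ := exists_coe_eq (hf.ne_bot y) (ne_top_of_mem_subdiff hf hv)
  have h1 := subdiff_real hu ha hb
  have h2 := subdiff_real hv hb ha
  simp only [inner_sub_left, inner_sub_right, real_inner_comm] at *
  linarith

/-- The subdifferential of a strongly convex function is strongly monotone. -/
theorem IsStronglyConvex.exists_strongly_monotone {f : H → EReal} (hf : IsProperConvexLsc f)
    (hs : IsStronglyConvex f) : ∃ μ : ℝ, 0 < μ ∧ ∀ x y u v : H, u ∈ subdiff f x →
      v ∈ subdiff f y → μ * ‖x - y‖ ^ 2 ≤ ⟪x - y, u - v⟫_ℝ := by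
  obtain ⟨η, hη, h⟩ := hs
  refine ⟨η / 2, by positivity, fun x y u v hu hv => ?_⟩
  obtain ⟨a, ha⟩ := exists_coe_eq (hf.ne_bot x) (ne_top_of_mem_subdiff hf hu)
  obtain ⟨b, hb⟩ := exists_coe_eq (hf.ne_bot y) (ne_top_of_mem_subdiff hf hv)
  -- Testing only the midpoint loses a factor 2: the modulus obtained is η / 2, and any positive one
  -- suffices.
  have h0 := h x y (1 / 2) (1 / 2) (by norm_num) (by norm_num) (by norm_num)
  set m : H := (1 / 2 : ℝ) • x + (1 / 2 : ℝ) • y with hm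
  rw [ha, hb] at h0
  have hmt : f m ≠ ⊤ := by
    intro hmt
    rw [hmt, EReal.top_add_coe, top_le_iff] at h0
    exact EReal.coe_ne_top ((1 / 2) * a + (1 / 2) * b) (by exact_mod_cast h0)
  obtain ⟨c, hc⟩ := exists_coe_eq (hf.ne_bot m) hmt
  rw [hc] at h0
  have h0' : c + 1 / 2 * (1 / 2) * (η / 2) * ‖x - y‖ ^ 2 ≤ 1 / 2 * a + 1 / 2 * b := by
    exact_mod_cast h0
  have h1 := subdiff_real hu ha hc
  have h2 := subdiff_real hv hb hc
  have e1 : m - x = (1 / 2 : ℝ) • (y - x) := by rw [hm]; module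
  have e2 : m - y = (1 / 2 : ℝ) • (x - y) := by rw [hm]; module
  rw [e1, inner_smul_right] at h1
  rw [e2, inner_smul_right] at h2
  simp only [inner_sub_left, inner_sub_right, real_inner_comm] at *
  linarith

variable [CompleteSpace H]

theorem hasDerivAt_comp_line {φ : H → ℝ} {d u e : H} {s : ℝ} (h : HasGradientAt φ d (u + s • e)) :
    HasDerivAt (fun t : ℝ => φ (u + t • e)) ⟪d, e⟫_ℝ s := by
  have h1 : HasDerivAt (fun t : ℝ => u + t • e) e s := by
    simpa using ((hasDerivAt_id s).smul_const e).const_add u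
  exact h.hasFDerivAt.comp_hasDerivAt s h1

/-- The right slopes of φ at u along e are at most c, hence so is their limit. The gradient
inequality and Fermat's rule both reduce to this. -/
theorem inner_le_of_forall_sub_le {φ : H → ℝ} {d u e : H} {c : ℝ} (h : HasGradientAt φ d u)
    (hc : ∀ s : ℝ, 0 < s → s < 1 → φ (u + s • e) - φ u ≤ s * c) : ⟪d, e⟫_ℝ ≤ c := by
  have h1 : HasDerivAt (fun t : ℝ => φ (u + t • e)) ⟪d, e⟫_ℝ 0 :=
    hasDerivAt_comp_line (by simpa using h)
  have h2 := (hasDerivWithinAt_iff_tendsto_slope' self_notMem_Ioi).1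
    (h1.hasDerivWithinAt (s := Ioi 0))
  refine le_of_tendsto h2 ?_
  filter_upwards [Ioo_mem_nhdsGT (zero_lt_one' ℝ)] with s hs
  rw [slope_def_field]
  simp only [zero_smul, add_zero, sub_zero]
  rw [div_le_iff₀ hs.1]
  linarith [hc s hs.1 hs.2]

/-- The gradient inequality for differentiable convex functions. -/
theorem add_inner_gradient_le {φ : H → ℝ} (hc : ConvexOn ℝ univ φ) (hd : Differentiable ℝ φ)
    (x y : H) : φ x + ⟪gradient φ x, y - x⟫_ℝ ≤ φ y := by
  have := inner_le_of_forall_sub_le (e := y - x) (c := φ y - φ x) (hd x).hasGradientAt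
    (fun s hs hs1 => by
      have := hc.2 (mem_univ x) (mem_univ y) (sub_nonneg.2 hs1.le) hs.le (sub_add_cancel 1 s)
      have e : (1 - s) • x + s • y = x + s • (y - x) := by module
      rw [e] at this
      simp only [smul_eq_mul] at this
      linarith)
  linarith

/-- Descent lemma. Along the segment, φ minus its quadratic upper model has derivative ⟪∇φ(x + s e)
- ∇φ(x), e⟫ - L s‖e‖² ≤ 0. -/
theorem le_add_of_lipschitz_gradient {φ : H → ℝ} {L : ℝ≥0} (hd : Differentiable ℝ φ)
    (hL : LipschitzWith L (gradient φ)) (x e : H) :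
    φ (x + e) ≤ φ x + ⟪gradient φ x, e⟫_ℝ + L / 2 * ‖e‖ ^ 2 := by
  let F : ℝ → ℝ := fun s => φ (x + s • e) - s * ⟪gradient φ x, e⟫_ℝ - L / 2 * ‖e‖ ^ 2 * s ^ 2
  have hF : ∀ s, HasDerivAt F (⟪gradient φ (x + s • e), e⟫_ℝ - 1 * ⟪gradient φ x, e⟫_ℝ
      - L / 2 * ‖e‖ ^ 2 * (2 * s)) s := fun s => by
    have h1 := hasDerivAt_comp_line (e := e) (s := s) (hd (x + s • e)).hasGradientAt
    have h2 := (hasDerivAt_id s).mul_const ⟪gradient φ x, e⟫_ℝ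
    have h3 := (hasDerivAt_pow 2 s).const_mul (L / 2 * ‖e‖ ^ 2 : ℝ)
    refine ((h1.sub h2).sub h3).congr_deriv ?_
    norm_num
  have hanti : AntitoneOn F (Icc 0 1) := by
    refine antitoneOn_of_deriv_nonpos (convex_Icc 0 1)
      (fun s _ => (hF s).continuousAt.continuousWithinAt)
      (fun s _ => (hF s).differentiableAt.differentiableWithinAt) (fun s hs => ?_)
    rw [interior_Icc] at hs
    rw [(hF s).deriv, one_mul, ← inner_sub_left]
    have h1 := real_inner_le_norm (gradient φ (x + s • e) - gradient φ x) e
    have h2 := hL.dist_le_mul (x + s • e) x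
    rw [dist_eq_norm, dist_eq_norm, add_sub_cancel_left, norm_smul, Real.norm_of_nonneg hs.1.le]
      at h2
    nlinarith [mul_le_mul_of_nonneg_right h2 (norm_nonneg e)]
  have := hanti (left_mem_Icc.2 zero_le_one) (right_mem_Icc.2 zero_le_one) zero_le_one
  simp only [F, one_smul, zero_smul, add_zero] at this
  linarith

/-- The Baillon–Haddad theorem: the gradient of a convex function with `L`-Lipschitz gradient is
`1 / L`-cocoercive. -/
theorem cocoercive_gradient {φ : H → ℝ} {L : ℝ≥0} (hL0 : 0 < L) (hc : ConvexOn ℝ univ φ)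
    (hd : Differentiable ℝ φ) (hL : LipschitzWith L (gradient φ)) (x y : H) :
    ‖gradient φ x - gradient φ y‖ ^ 2 ≤ L * ⟪x - y, gradient φ x - gradient φ y⟫_ℝ := by
  have hL0' : (0 : ℝ) < L := hL0
  -- Compare at the gradient step x - b / L: the descent lemma from x bounds φ there from above, the
  -- gradient inequality from y from below. Adding the estimate to its copy with x and y exchanged
  -- cancels the function values.
  have key : ∀ x y : H, ‖gradient φ x - gradient φ y‖ ^ 2 ≤
      2 * L * (φ x - φ y - ⟪gradient φ y, x - y⟫_ℝ) := fun x y => by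
    set b := gradient φ x - gradient φ y with hb
    have h1 := le_add_of_lipschitz_gradient hd hL x (-(L : ℝ)⁻¹ • b)
    have h2 := add_inner_gradient_le hc hd y (x + -(L : ℝ)⁻¹ • b)
    have e : x + -(L : ℝ)⁻¹ • b - y = (x - y) + -(L : ℝ)⁻¹ • b := by abel
    rw [e, inner_add_right] at h2
    rw [inner_smul_right] at h1 h2
    rw [norm_smul, mul_pow, norm_neg, norm_inv, Real.norm_of_nonneg hL0'.le] at h1
    have h3 : ‖b‖ ^ 2 = ⟪gradient φ x, b⟫_ℝ - ⟪gradient φ y, b⟫_ℝ := by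
      rw [← inner_sub_left, ← hb, real_inner_self_eq_norm_sq]
    have h4 : (L : ℝ) / 2 * ((L : ℝ)⁻¹ ^ 2 * ‖b‖ ^ 2) = (L : ℝ)⁻¹ * ‖b‖ ^ 2 / 2 := by
      field_simp
    rw [h4] at h1
    have h5 : (L : ℝ)⁻¹ * ‖b‖ ^ 2 / 2 ≤ φ x - φ y - ⟪gradient φ y, x - y⟫_ℝ := by
      have : (L : ℝ)⁻¹ * ‖b‖ ^ 2 =
          (L : ℝ)⁻¹ * ⟪gradient φ x, b⟫_ℝ - (L : ℝ)⁻¹ * ⟪gradient φ y, b⟫_ℝ := by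
        rw [h3]; ring
      linarith
    calc ‖b‖ ^ 2 = 2 * L * ((L : ℝ)⁻¹ * ‖b‖ ^ 2 / 2) := by field_simp
      _ ≤ _ := by gcongr
  have h1 := key x y
  have h2 := key y x
  rw [norm_sub_rev] at h2
  have h3 : ⟪x - y, gradient φ x - gradient φ y⟫_ℝ =
      -⟪gradient φ y, x - y⟫_ℝ - ⟪gradient φ x, y - x⟫_ℝ := by
    simp only [inner_sub_left, inner_sub_right, real_inner_comm]; ring
  rw [h3]
  nlinarith

/-- Fermat's rule for the sum of a convex function and a function differentiable at the point. -/
theorem neg_mem_subdiff_of_isMin {F : H → EReal} (hF : IsProperConvexLsc F) {φ : H → ℝ} {d u : H}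
    (hφ : HasGradientAt φ d u) (hmin : ∀ y, F u + (φ u : EReal) ≤ F y + (φ y : EReal)) :
    -d ∈ subdiff F u := by
  have hu : F u ≠ ⊤ := by
    obtain ⟨y, hy⟩ := hF.proper
    obtain ⟨b, hb⟩ := exists_coe_eq (hF.ne_bot y) hy
    intro h
    have := hmin y
    rw [h, EReal.top_add_coe, top_le_iff, hb] at this
    exact EReal.coe_ne_top (b + φ y) (by exact_mod_cast this)
  obtain ⟨a, ha⟩ := exists_coe_eq (hF.ne_bot u) hu
  intro y
  by_cases hy : F y = ⊤
  · rw [hy]; exact le_top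
  obtain ⟨b, hb⟩ := exists_coe_eq (hF.ne_bot y) hy
  -- Minimality and convexity along the segment give φ(u) - φ(u + s(y - u)) ≤ F(u + s(y - u)) - F(u)
  -- ≤ s (b - a).
  have := inner_le_of_forall_sub_le (φ := fun z => -φ z) (d := -d) (u := u) (e := y - u)
    (c := b - a) (by
      have := hφ.hasFDerivAt.neg
      rw [← map_neg] at this
      exact hasGradientAt_iff_hasFDerivAt.2 this) (fun s hs hs1 => by
      have h1 := hF.convex u y (1 - s) s (by linarith) hs (by ring)
      have e : (1 - s) • u + s • y = u + s • (y - u) := by module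
      have h2 := hmin (u + s • (y - u))
      rw [e, ha, hb] at h1
      rw [ha] at h2
      have h3 := h2.trans (add_le_add_left h1 _)
      have h4 : a + φ u ≤ (1 - s) * a + s * b + φ (u + s • (y - u)) := by exact_mod_cast h3
      linarith)
  rw [ha, hb]
  exact_mod_cast (by linarith : a + ⟪-d, y - u⟫_ℝ ≤ b)

theorem hasGradientAt_mul_norm_sub_sq (c : ℝ) (x u : H) :
    HasGradientAt (fun y => c * ‖y - x‖ ^ 2) ((2 * c) • (u - x)) u := by
  rw [hasGradientAt_iff_hasFDerivAt]
  have h := ((hasFDerivAt_id u).sub_const x).norm_sq.const_mul c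
  refine h.congr_fderiv ?_
  ext v
  simp
  ring

theorem smul_sub_mem_subdiff_of_mem_prox {f : H → EReal} (hf : IsProperConvexLsc f) {r : ℝ}
    (hr : 0 < r) {x p : H} (hp : p ∈ prox r f x) : r⁻¹ • (x - p) ∈ subdiff f p := by
  have := neg_mem_subdiff_of_isMin hf (hasGradientAt_mul_norm_sub_sq (1 / (2 * r)) x p) hp
  convert this using 1
  have : 2 * (1 / (2 * r)) = r⁻¹ := by field_simp
  rw [this, ← smul_neg, neg_sub]

theorem zer_gradient_eq_argmin {ψ : H → ℝ} (hc : ConvexOn ℝ univ ψ) (hd : Differentiable ℝ ψ) :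
    zer (singleValued (gradient ψ)) = argmin ψ := by
  ext x
  simp only [zer, singleValued, argmin, mem_ofPred_eq, mem_singleton_iff]
  constructor
  · intro h y
    simpa [← h] using add_inner_gradient_le hc hd x y
  · intro h
    have hm : IsLocalMin ψ x := Filter.Eventually.of_forall h
    have := hm.fderiv_eq_zero
    simp [gradient, this]

end ConvexAnalysis
end Bilevel

namespace Bilevel

/-! ### The function f + δ_C and its subdifferential. -/

section Restriction

open Classical in
/-- The sum of `f` and the indicator function of `C`. -/
noncomputable def restrictTo {X : Type*} (f : X → EReal) (C : Set X) : X → EReal :=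
  fun x => if x ∈ C then f x else ⊤

theorem restrictTo_of_mem {X : Type*} (f : X → EReal) {C : Set X} {x : X} (h : x ∈ C) :
    restrictTo f C x = f x := if_pos h

theorem restrictTo_of_notMem {X : Type*} (f : X → EReal) {C : Set X} {x : X} (h : x ∉ C) :
    restrictTo f C x = ⊤ := if_neg h

theorem le_restrictTo {X : Type*} (f : X → EReal) (C : Set X) (x : X) :
    f x ≤ restrictTo f C x := by
  by_cases h : x ∈ C
  · exact (restrictTo_of_mem f h).ge
  · rw [restrictTo_of_notMem f h]; exact le_top

variable {H : Type*} [NormedAddCommGroup H] [InnerProductSpace ℝ H]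

theorem coe_mul_ne_bot {a : ℝ} (ha : 0 < a) {b : EReal} (hb : b ≠ ⊥) : (a : EReal) * b ≠ ⊥ := by
  induction b with
  | bot => exact absurd rfl hb
  | coe r => exact_mod_cast EReal.coe_ne_bot (a * r)
  | top => rw [EReal.coe_mul_top_of_pos ha]; exact top_ne_bot

theorem IsProperConvexLsc.restrictTo {f : H → EReal} (hf : IsProperConvexLsc f) {C : Set H}
    (hC : Convex ℝ C) (hCc : IsClosed C) (hne : ∃ x ∈ C, f x ≠ ⊤) :
    IsProperConvexLsc (restrictTo f C) where
  ne_bot x h := hf.ne_bot x (le_bot_iff.1 (h ▸ le_restrictTo f C x))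
  proper := by
    obtain ⟨x, hx, h⟩ := hne
    exact ⟨x, by rwa [restrictTo_of_mem f hx]⟩
  convex x y a b ha hb hab := by
    have hbot : ∀ z, Bilevel.restrictTo f C z ≠ ⊥ := fun z h =>
      hf.ne_bot z (le_bot_iff.1 (h ▸ le_restrictTo f C z))
    by_cases hx : x ∈ C
    · by_cases hy : y ∈ C
      · rw [restrictTo_of_mem f hx, restrictTo_of_mem f hy,
          restrictTo_of_mem f (hC hx hy ha.le hb.le hab)]
        exact hf.convex x y a b ha hb hab
      · rw [restrictTo_of_notMem f hy, EReal.coe_mul_top_of_pos hb,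
          EReal.add_top_of_ne_bot (coe_mul_ne_bot ha (hbot x))]
        exact le_top
    · rw [restrictTo_of_notMem f hx, EReal.coe_mul_top_of_pos ha,
        EReal.top_add_of_ne_bot (coe_mul_ne_bot hb (hbot y))]
      exact le_top
  lsc x y hy := by
    change y < Bilevel.restrictTo f C x at hy
    change ∀ᶠ z in 𝓝 x, y < Bilevel.restrictTo f C z
    by_cases hx : x ∈ C
    · rw [restrictTo_of_mem f hx] at hy
      filter_upwards [hf.lsc x y hy] with z hz using hz.trans_le (le_restrictTo f C z)
    · filter_upwards [hCc.isOpen_compl.mem_nhds hx] with z hz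
      rw [restrictTo_of_notMem f hz]
      rwa [restrictTo_of_notMem f hx] at hy

theorem add_mem_subdiff_restrictTo {f : H → EReal} {C : Set H} {x u p : H}
    (hu : u ∈ subdiff f x) (hp : p ∈ normalCone C x) : u + p ∈ subdiff (restrictTo f C) x := by
  intro y
  by_cases hy : y ∈ C
  · rw [restrictTo_of_mem f hp.1, restrictTo_of_mem f hy]
    refine le_trans ?_ (hu y)
    gcongr
    rw [inner_add_left, real_inner_comm _ p]
    linarith [hp.2 y hy]
  · rw [restrictTo_of_notMem f hy]; exact le_top

/-- The subdifferential of f + δ_C is a monotone extension of ∂f + N_C, so maximality forces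
equality; no further qualification condition is needed. -/
theorem subdiff_restrictTo {f : H → EReal} {C : Set H}
    (hF : IsProperConvexLsc (restrictTo f C))
    (hmax : IsMaximallyMonotone (opAdd (subdiff f) (normalCone C))) (x : H) :
    subdiff (restrictTo f C) x = opAdd (subdiff f) (normalCone C) x := by
  refine hmax.2 _ (isMonotoneOp_subdiff hF) ?_ x
  rintro x _ ⟨u, hu, p, hp, rfl⟩
  exact add_mem_subdiff_restrictTo hu hp

/-- A proper convex lower semicontinuous function bounded from below has a proximal point. -/
theorem exists_isMin_add_norm_sub_sq [CompleteSpace H] {F : H → EReal} (hF : IsProperConvexLsc F)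
    {g : H → ℝ} (hg : ConvexOn ℝ univ g) (hgc : Continuous g) {m₀ : ℝ}
    (hm₀ : ∀ y, ∀ a : ℝ, F y = a → m₀ ≤ a + g y) (z : H) :
    ∃ u, ∀ y, F u + ((g u + 1 / 2 * ‖u - z‖ ^ 2 : ℝ) : EReal) ≤
      F y + ((g y + 1 / 2 * ‖y - z‖ ^ 2 : ℝ) : EReal) := by
  set S : Set ℝ := {s | ∃ y, ∃ a : ℝ, F y = a ∧ s = a + (g y + 1 / 2 * ‖y - z‖ ^ 2)} with hS
  have hSb : BddBelow S := by
    refine ⟨m₀, ?_⟩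
    rintro _ ⟨y, a, ha, rfl⟩
    have := hm₀ y a ha
    have : 0 ≤ 1 / 2 * ‖y - z‖ ^ 2 := by positivity
    linarith
  have hSn : S.Nonempty := by
    obtain ⟨y, hy⟩ := hF.proper
    obtain ⟨a, ha⟩ := exists_coe_eq (hF.ne_bot y) hy
    exact ⟨_, y, a, ha, rfl⟩
  set m := sInf S with hm
  have hex : ∀ n : ℕ, ∃ y, ∃ a : ℝ, F y = a ∧
      a + (g y + 1 / 2 * ‖y - z‖ ^ 2) < m + 1 / ((n : ℝ) + 1) := fun n => by
    obtain ⟨_, ⟨y, a, ha, rfl⟩, hlt⟩ := exists_lt_of_csInf_lt hSn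
      (show sInf S < m + 1 / ((n : ℝ) + 1) by
        have : 0 < 1 / ((n : ℝ) + 1) := by positivity
        linarith)
    exact ⟨y, a, ha, hlt⟩
  choose y a hya hlt using hex
  -- The parallelogram identity at the midpoint of two almost minimizers shows that the minimizing
  -- sequence is Cauchy.
  have hmid : ∀ n k, ‖y n - y k‖ ^ 2 ≤ 4 * (1 / ((n : ℝ) + 1) + 1 / ((k : ℝ) + 1)) := by
    intro n k
    have h1 := hF.convex (y n) (y k) (1 / 2) (1 / 2) (by norm_num) (by norm_num) (by norm_num)
    have h2 := hg.2 (mem_univ (y n)) (mem_univ (y k))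
      (show (0 : ℝ) ≤ 1 / 2 by norm_num) (show (0 : ℝ) ≤ 1 / 2 by norm_num) (by norm_num)
    set w : H := (1 / 2 : ℝ) • y n + (1 / 2 : ℝ) • y k with hw
    rw [hya, hya] at h1
    have hwt : F w ≠ ⊤ := by
      intro h
      rw [h, top_le_iff] at h1
      exact EReal.coe_ne_top (1 / 2 * a n + 1 / 2 * a k) (by exact_mod_cast h1)
    obtain ⟨c, hc⟩ := exists_coe_eq (hF.ne_bot w) hwt
    rw [hc] at h1
    have h1' : c ≤ 1 / 2 * a n + 1 / 2 * a k := by exact_mod_cast h1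
    have h3 : m ≤ c + (g w + 1 / 2 * ‖w - z‖ ^ 2) := csInf_le hSb ⟨w, c, hc, rfl⟩
    have h4 : ‖w - z‖ ^ 2 =
        1 / 2 * ‖y n - z‖ ^ 2 + 1 / 2 * ‖y k - z‖ ^ 2 - 1 / 4 * ‖y n - y k‖ ^ 2 := by
      have e1 : w - z = (1 / 2 : ℝ) • ((y n - z) + (y k - z)) := by rw [hw]; module
      have e2 : y n - y k = (y n - z) - (y k - z) := by abel
      rw [e1, e2, norm_smul, mul_pow, norm_add_sq_real,
        norm_sub_sq_real (y n - z) (y k - z)]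
      norm_num
      ring
    simp only [smul_eq_mul] at h2
    linarith [hlt n, hlt k]
  have hcau : CauchySeq y := by
    refine cauchySeq_of_le_tendsto_0 (fun N : ℕ => √(8 * (1 / ((N : ℝ) + 1)))) ?_ ?_
    · intro n k N hn hk
      rw [dist_eq_norm]
      refine Real.le_sqrt_of_sq_le ((hmid n k).trans ?_)
      have h1 : 1 / ((n : ℝ) + 1) ≤ 1 / ((N : ℝ) + 1) := by gcongr
      have h2 : 1 / ((k : ℝ) + 1) ≤ 1 / ((N : ℝ) + 1) := by gcongr
      linarith
    · have := ((tendsto_one_div_add_atTop_nhds_zero_nat (𝕜 := ℝ)).const_mul 8).sqrt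
      simpa using this
  obtain ⟨u, hu⟩ := cauchySeq_tendsto_of_complete hcau
  -- Lower semicontinuity of F and continuity of the finite part show that the limit attains the
  -- infimum.
  have hFu : F u ≤ ((m - (g u + 1 / 2 * ‖u - z‖ ^ 2) : ℝ) : EReal) := by
    by_contra! hcon
    obtain ⟨r, hr1, hr2⟩ := EReal.lt_iff_exists_real_btwn.1 hcon
    have hr1' := EReal.coe_lt_coe_iff.1 hr1
    have hev := hu.eventually (hF.lsc u r hr2)
    have hlim : Tendsto (fun n : ℕ => m + 1 / ((n : ℝ) + 1) -
        (g (y n) + 1 / 2 * ‖y n - z‖ ^ 2)) atTop (𝓝 (m + 0 - (g u + 1 / 2 * ‖u - z‖ ^ 2))) := by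
      refine (tendsto_const_nhds.add tendsto_one_div_add_atTop_nhds_zero_nat).sub ?_
      have hcont : Continuous fun v => g v + 1 / 2 * ‖v - z‖ ^ 2 := by fun_prop
      exact (hcont.tendsto u).comp hu
    have := ge_of_tendsto hlim (b := r) (by
      filter_upwards [hev] with n hn
      rw [hya] at hn
      have := EReal.coe_lt_coe_iff.1 hn
      linarith [hlt n])
    linarith
  refine ⟨u, fun v => ?_⟩
  by_cases hv : F v = ⊤
  · rw [hv, EReal.top_add_coe]; exact le_top
  obtain ⟨b, hb⟩ := exists_coe_eq (hF.ne_bot v) hv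
  have hmv : m ≤ b + (g v + 1 / 2 * ‖v - z‖ ^ 2) := csInf_le hSb ⟨v, b, hb, rfl⟩
  rw [hb]
  refine (add_le_add_left hFu _).trans ?_
  exact_mod_cast (by linarith)

end Restriction

/-! ### Zeros of the optimality operator and solutions of (P). -/

section Optimality

variable {H : Type*} [NormedAddCommGroup H] [InnerProductSpace ℝ H] [CompleteSpace H]
  {f : H → EReal} {g ψ : H → ℝ}

theorem mem_zer_optimalityOp {x : H} : x ∈ zer (optimalityOp f g ψ) ↔
    ∃ v ∈ subdiff f x, ∃ p ∈ normalCone (zer (singleValued (gradient ψ))) x,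
      v + gradient g x + p = 0 := by
  constructor
  · rintro ⟨_, ⟨v, hv, d, hd, rfl⟩, p, hp, h⟩
    rw [singleValued, mem_singleton_iff] at hd
    subst hd
    exact ⟨v, hv, p, hp, h.symm⟩
  · rintro ⟨v, hv, p, hp, h⟩
    exact ⟨_, ⟨v, hv, _, rfl, rfl⟩, p, hp, h.symm⟩

/-- The sum of `f` and the indicator function of the set of critical points of `ψ` is proper,
convex and lower semicontinuous. -/
theorem isProperConvexLsc_restrictTo_zer (hf : IsProperConvexLsc f) (hψ : ConvexOn ℝ univ ψ)
    (hψd : Differentiable ℝ ψ) (hsolv : (zer (optimalityOp f g ψ)).Nonempty) :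
    IsProperConvexLsc (restrictTo f (zer (singleValued (gradient ψ)))) := by
  obtain ⟨x, hx⟩ := hsolv
  obtain ⟨v, hv, p, hp, -⟩ := mem_zer_optimalityOp.1 hx
  have hset : argmin ψ = {y | ψ y ≤ ψ x} := by
    have hx' : x ∈ argmin ψ := zer_gradient_eq_argmin hψ hψd ▸ hp.1
    ext y
    exact ⟨fun h => h x, fun h z => le_trans h (hx' z)⟩
  refine hf.restrictTo ?_ ?_ ⟨x, hp.1, ne_top_of_mem_subdiff hf hv⟩
  · rw [zer_gradient_eq_argmin hψ hψd, hset]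
    simpa using hψ.convex_le (ψ x)
  · rw [zer_gradient_eq_argmin hψ hψd, hset]
    exact isClosed_le hψd.continuous continuous_const

theorem isOptimalSolution_of_mem_zer (hf : IsProperConvexLsc f) (hg : ConvexOn ℝ univ g)
    (hgd : Differentiable ℝ g) (hψ : ConvexOn ℝ univ ψ) (hψd : Differentiable ℝ ψ) {x : H}
    (hx : x ∈ zer (optimalityOp f g ψ)) : IsOptimalSolution f g ψ x := by
  obtain ⟨v, hv, p, hp, h0⟩ := mem_zer_optimalityOp.1 hx
  rw [zer_gradient_eq_argmin hψ hψd] at hp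
  refine ⟨hp.1, fun y hy => ?_⟩
  by_cases hyt : f y = ⊤
  · rw [hyt, EReal.top_add_coe]; exact le_top
  obtain ⟨a, ha⟩ := exists_coe_eq (hf.ne_bot x) (ne_top_of_mem_subdiff hf hv)
  obtain ⟨b, hb⟩ := exists_coe_eq (hf.ne_bot y) hyt
  have h1 := subdiff_real hv ha hb
  have h2 := add_inner_gradient_le hg hgd x y
  have h3 := hp.2 y hy
  have h4 : ⟪v + gradient g x + p, y - x⟫_ℝ = 0 := by rw [h0, inner_zero_left]
  rw [inner_add_left, inner_add_left, real_inner_comm _ p] at h4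
  rw [ha, hb]
  exact_mod_cast (by linarith)

theorem mem_zer_of_neg_gradient_mem
    (hF : IsProperConvexLsc (restrictTo f (zer (singleValued (gradient ψ)))))
    (hmax : IsMaximallyMonotone
      (opAdd (subdiff f) (normalCone (zer (singleValued (gradient ψ)))))) {x : H}
    (h : -gradient g x ∈ subdiff (restrictTo f (zer (singleValued (gradient ψ)))) x) :
    x ∈ zer (optimalityOp f g ψ) := by
  rw [subdiff_restrictTo hF hmax] at h
  obtain ⟨v, hv, p, hp, h⟩ := h
  refine mem_zer_optimalityOp.2 ⟨v, hv, p, hp, ?_⟩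
  rw [add_right_comm, ← h, neg_add_cancel]

/-- An optimal solution minimizes (f + δ_C) + g; Fermat's rule puts -∇g(x) in the subdifferential of
f + δ_C, which splits as ∂f + N_C. -/
theorem zer_optimalityOp_eq (hf : IsProperConvexLsc f) (hg : ConvexOn ℝ univ g)
    (hgd : Differentiable ℝ g) (hψ : ConvexOn ℝ univ ψ) (hψd : Differentiable ℝ ψ)
    (hmax : IsMaximallyMonotone
      (opAdd (subdiff f) (normalCone (zer (singleValued (gradient ψ))))))
    (hsolv : (zer (optimalityOp f g ψ)).Nonempty) :
    zer (optimalityOp f g ψ) = {x | IsOptimalSolution f g ψ x} := by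
  ext x
  refine ⟨isOptimalSolution_of_mem_zer hf hg hgd hψ hψd, fun hx => ?_⟩
  have hF := isProperConvexLsc_restrictTo_zer hf hψ hψd hsolv
  refine mem_zer_of_neg_gradient_mem hF hmax
    (neg_mem_subdiff_of_isMin hF (hgd x).hasGradientAt fun y => ?_)
  rw [zer_gradient_eq_argmin hψ hψd, restrictTo_of_mem f hx.1]
  by_cases hy : y ∈ argmin ψ
  · rw [restrictTo_of_mem f hy]; exact hx.2 y hy
  · rw [restrictTo_of_notMem f hy, EReal.top_add_coe]; exact le_top

/-- A point monotonically related to the graph of the optimality operator is a zero of it. -/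
theorem mem_zer_of_forall_inner_nonneg (hf : IsProperConvexLsc f) (hg : ConvexOn ℝ univ g)
    (hgd : Differentiable ℝ g) (hψ : ConvexOn ℝ univ ψ) (hψd : Differentiable ℝ ψ)
    (hmax : IsMaximallyMonotone
      (opAdd (subdiff f) (normalCone (zer (singleValued (gradient ψ))))))
    (hsolv : (zer (optimalityOp f g ψ)).Nonempty) {z : H}
    (hz : ∀ u v p : H, v ∈ subdiff f u → p ∈ normalCone (zer (singleValued (gradient ψ))) u →
      0 ≤ ⟪u - z, v + gradient g u + p⟫_ℝ) : z ∈ zer (optimalityOp f g ψ) := by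
  have hF := isProperConvexLsc_restrictTo_zer hf hψ hψd hsolv
  obtain ⟨xs, hxs⟩ := hsolv
  have hopt := isOptimalSolution_of_mem_zer hf hg hgd hψ hψd hxs
  obtain ⟨vs, hvs, -⟩ := mem_zer_optimalityOp.1 hxs
  obtain ⟨as, has⟩ := exists_coe_eq (hf.ne_bot xs) (ne_top_of_mem_subdiff hf hvs)
  -- The value of (P), attained at `xs`, is the required lower bound. The minimizer u solves z - u ∈
  -- ∂f(u) + ∇g(u) + N_C(u).
  obtain ⟨u, hu⟩ := exists_isMin_add_norm_sub_sq hF hg hgd.continuous (m₀ := as + g xs)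
    (fun y a ha => by
      by_cases hy : y ∈ zer (singleValued (gradient ψ))
      · rw [restrictTo_of_mem f hy] at ha
        rw [zer_gradient_eq_argmin hψ hψd] at hy
        have := hopt.2 y hy
        rw [has, ha] at this
        exact_mod_cast this
      · rw [restrictTo_of_notMem f hy] at ha
        exact absurd ha.symm (EReal.coe_ne_top a)) z
  have hgrad : HasGradientAt (fun y => g y + 1 / 2 * ‖y - z‖ ^ 2) (gradient g u + (u - z)) u := by
    have h1 := (hgd u).hasGradientAt.hasFDerivAt.add
      (hasGradientAt_mul_norm_sub_sq (1 / 2) z u).hasFDerivAt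
    rw [← map_add] at h1
    have := hasGradientAt_iff_hasFDerivAt.2 h1
    simpa using! this
  have hsub := neg_mem_subdiff_of_isMin hF hgrad hu
  -- Testing the hypothesis at u with the element z - u gives 0 ≤ -‖u - z‖².
  have huz : u = z := by
    have hsub' := hsub
    rw [subdiff_restrictTo hF hmax] at hsub'
    obtain ⟨v, hv, p, hp, h⟩ := hsub'
    have h1 := hz u v p hv hp
    have h2 : v + gradient g u + p = -(u - z) := by
      rw [add_right_comm, ← h]; abel
    rw [h2, inner_neg_right, real_inner_self_eq_norm_sq] at h1
    have : ‖u - z‖ = 0 := by nlinarith [norm_nonneg (u - z)]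
    exact sub_eq_zero.1 (norm_eq_zero.1 this)
  subst huz
  rw [sub_self, add_zero] at hsub
  exact mem_zer_of_neg_gradient_mem hF hmax hsub

end Optimality

end Bilevel

namespace Bilevel

/-! ### Absolutely continuous functions, differential inequalities and weighted averages on the
half-line. -/

section AbsoluteContinuity

theorem LocallyAC.continuousOn {E : Type*} [NormedAddCommGroup E] {x : ℝ → E} (hx : LocallyAC x) :
    ContinuousOn x (Ici 0) := by
  intro t ht
  have ht0 : (0 : ℝ) ≤ t := ht
  have h1 : (0 : ℝ) < t + 1 := by linarith
  have h := (hx (t + 1) h1).continuousOn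
  rw [uIcc_of_le h1.le] at h
  have hmem : Icc 0 (t + 1) ∈ 𝓝[Ici 0] t :=
    inter_mem self_mem_nhdsWithin (mem_nhdsWithin_of_mem_nhds (Iic_mem_nhds (lt_add_one t)))
  exact (h t ⟨ht0, (lt_add_one t).le⟩).mono_of_mem_nhdsWithin hmem

theorem LocallyAC.congr {X : Type*} [PseudoMetricSpace X] {x y : ℝ → X} (hx : LocallyAC x)
    (h : ∀ t, x t = y t) : LocallyAC y := by
  rwa [← funext h]

theorem LocallyAC.sub_const {E : Type*} [NormedAddCommGroup E] {x : ℝ → E} (hx : LocallyAC x)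
    (u : E) : LocallyAC fun t => x t - u := fun b hb =>
  (hx b hb).fun_sub (LipschitzWith.const u).lipschitzOnWith.absolutelyContinuousOnInterval

theorem LocallyAC.fun_add {E : Type*} [NormedAddCommGroup E] {x y : ℝ → E} (hx : LocallyAC x)
    (hy : LocallyAC y) : LocallyAC fun t => x t + y t := fun b hb => (hx b hb).fun_add (hy b hb)

theorem LocallyAC.fun_sub {E : Type*} [NormedAddCommGroup E] {x y : ℝ → E} (hx : LocallyAC x)
    (hy : LocallyAC y) : LocallyAC fun t => x t - y t := fun b hb => (hx b hb).fun_sub (hy b hb)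

theorem LocallyAC.fun_mul {x y : ℝ → ℝ} (hx : LocallyAC x) (hy : LocallyAC y) :
    LocallyAC fun t => x t * y t := fun b hb => (hx b hb).fun_mul (hy b hb)

theorem LocallyAC.const_mul {x : ℝ → ℝ} (c : ℝ) (hx : LocallyAC x) :
    LocallyAC fun t => c * x t := fun b hb => (hx b hb).const_mul c

theorem LocallyAC.norm {E : Type*} [NormedAddCommGroup E] {x : ℝ → E} (hx : LocallyAC x) :
    LocallyAC fun t => ‖x t‖ := fun b hb => by
  refine squeeze_zero (fun _ => Finset.sum_nonneg fun _ _ => dist_nonneg) (fun E => ?_) (hx b hb)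
  refine Finset.sum_le_sum fun i _ => ?_
  rw [dist_eq_norm (x _), Real.dist_eq]
  exact abs_norm_sub_norm_le _ _

theorem LocallyAC.norm_sq {E : Type*} [NormedAddCommGroup E] {x : ℝ → E} (hx : LocallyAC x) :
    LocallyAC fun t => ‖x t‖ ^ 2 :=
  (hx.norm.fun_mul hx.norm).congr fun _ => (sq _).symm

/-- Polarization reduces the inner product to squared norms, which are products of real functions.
-/
theorem LocallyAC.inner {H : Type*} [NormedAddCommGroup H] [InnerProductSpace ℝ H] {x y : ℝ → H}
    (hx : LocallyAC x) (hy : LocallyAC y) : LocallyAC fun t => ⟪x t, y t⟫_ℝ :=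
  (((hx.fun_add hy).norm_sq.fun_sub (hx.fun_sub hy).norm_sq).const_mul (1 / 4)).congr fun t => by
    rw [norm_add_sq_real, norm_sub_sq_real]; ring

theorem LocallyAC.intervalIntegrable_deriv {V : ℝ → ℝ} (hV : LocallyAC V) {s t : ℝ} (hs : 0 ≤ s)
    (hst : s ≤ t) : IntervalIntegrable (deriv V) volume s t := by
  refine ((hV (t + 1) (by linarith)).mono ?_).intervalIntegrable_deriv
  rw [uIcc_of_le hst, uIcc_of_le (by linarith)]
  exact Icc_subset_Icc hs (by linarith)

theorem LocallyAC.integral_deriv {V : ℝ → ℝ} (hV : LocallyAC V) {s t : ℝ} (hs : 0 ≤ s)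
    (hst : s ≤ t) : ∫ r in s..t, deriv V r = V t - V s := by
  refine ((hV (t + 1) (by linarith)).mono ?_).integral_deriv_eq_sub
  rw [uIcc_of_le hst, uIcc_of_le (by linarith)]
  exact Icc_subset_Icc hs (by linarith)

theorem LocallyAC.ae_differentiableAt {V : ℝ → ℝ} (hV : LocallyAC V) :
    ∀ᵐ t ∂(volume.restrict (Ici (0 : ℝ))), DifferentiableAt ℝ V t := by
  rw [ae_restrict_iff' measurableSet_Ici]
  have h : ∀ n : ℕ, ∀ᵐ t, t ∈ uIcc (0 : ℝ) (n + 1) → DifferentiableAt ℝ V t := fun n =>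
    (hV (n + 1) (by positivity)).ae_differentiableAt
  filter_upwards [ae_all_iff.2 h] with t ht ht0
  obtain ⟨n, hn⟩ := exists_nat_ge t
  refine ht n ?_
  rw [uIcc_of_le (by positivity)]
  exact ⟨ht0, by linarith⟩

theorem LocallyAC.antitoneOn {V : ℝ → ℝ} (hV : LocallyAC V)
    (h : ∀ᵐ t ∂(volume.restrict (Ici (0 : ℝ))), deriv V t ≤ 0) : AntitoneOn V (Ici 0) := by
  intro s hs t _ hst
  have h1 := hV.integral_deriv hs hst
  have h2 : ∫ r in s..t, deriv V r ≤ ∫ _ in s..t, (0 : ℝ) := by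
    refine intervalIntegral.integral_mono_ae_restrict hst (hV.intervalIntegrable_deriv hs hst)
      intervalIntegrable_const ?_
    exact ae_restrict_of_ae_restrict_of_subset (fun r hr => le_trans hs hr.1) h
  simp only [intervalIntegral.integral_zero] at h2
  linarith

/-- Integrating a differential inequality `V' + S ≤ R`. -/
theorem LocallyAC.integral_add_le {V R S : ℝ → ℝ} (hV : LocallyAC V) {T t : ℝ} (hT : 0 ≤ T)
    (hTt : T ≤ t) (hR : IntegrableOn R (Ici T)) (hS : IntervalIntegrable S volume T t)
    (h : ∀ᵐ r ∂(volume.restrict (Ici T)), deriv V r + S r ≤ R r) :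
    V t + ∫ r in T..t, S r ≤ V T + ∫ r in Ici T, |R r| := by
  have hRi : IntervalIntegrable R volume T t :=
    (intervalIntegrable_iff_integrableOn_Icc_of_le hTt).2 (hR.mono_set Icc_subset_Ici_self)
  have hVi := hV.intervalIntegrable_deriv hT hTt
  have h1 : ∫ r in T..t, (deriv V r + S r) ≤ ∫ r in T..t, R r :=
    intervalIntegral.integral_mono_ae_restrict hTt (hVi.add hS) hRi
      (ae_restrict_of_ae_restrict_of_subset Icc_subset_Ici_self h)
  rw [intervalIntegral.integral_add hVi hS, hV.integral_deriv hT hTt] at h1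
  have h2 : ∫ r in T..t, R r ≤ ∫ r in T..t, |R r| :=
    intervalIntegral.integral_mono_on hTt hRi hRi.abs fun r _ => le_abs_self _
  have h3 : ∫ r in T..t, |R r| ≤ ∫ r in Ici T, |R r| := by
    rw [intervalIntegral.integral_of_le hTt]
    refine setIntegral_mono_set hR.abs (Eventually.of_forall fun r => abs_nonneg _)
      (LE.le.eventuallyLE fun r hr => hr.1.le)
  linarith

/-- The dissipated quantity `G` in `V' + G ≤ R` is integrable if `V` is bounded from below. -/
theorem LocallyAC.integrableOn_of_deriv_add_le {V R G : ℝ → ℝ} (hV : LocallyAC V) {T M : ℝ}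
    (hT : 0 ≤ T) (hM : ∀ t, T ≤ t → M ≤ V t) (hR : IntegrableOn R (Ici T))
    (hG : AEStronglyMeasurable G (volume.restrict (Ici T)))
    (hG0 : ∀ᵐ r ∂(volume.restrict (Ici T)), 0 ≤ G r)
    (h : ∀ᵐ r ∂(volume.restrict (Ici T)), deriv V r + G r ≤ R r) : IntegrableOn G (Ici T) := by
  -- On bounded intervals 0 ≤ G ≤ R - V', and V' is integrable there.
  have hGi : ∀ t, T ≤ t → IntegrableOn G (Ioc T t) := fun t ht => by
    have hVi := (intervalIntegrable_iff_integrableOn_Ioc_of_le ht).1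
      (hV.intervalIntegrable_deriv hT ht)
    have hsub : Ioc T t ⊆ Ici T := fun r hr => hr.1.le
    refine Integrable.mono' ((hR.mono_set hsub).sub hVi) (hG.mono_set hsub) ?_
    filter_upwards [ae_restrict_of_ae_restrict_of_subset hsub hG0,
      ae_restrict_of_ae_restrict_of_subset hsub h] with r h1 h2
    rw [Real.norm_of_nonneg h1]
    simp only [Pi.sub_apply]
    linarith
  rw [integrableOn_Ici_iff_integrableOn_Ioi]
  refine integrableOn_Ioi_of_intervalIntegral_norm_bounded (V T + (∫ r in Ici T, |R r|) - M) T
    (b := fun t : ℝ => max T t) (l := atTop) (fun t => hGi _ (le_max_left _ _))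
    (tendsto_atTop_mono (fun t => le_max_right T t) tendsto_id) (Eventually.of_forall fun t => ?_)
  have ht := le_max_left T t
  have h1 := hV.integral_add_le hT ht hR
    ((intervalIntegrable_iff_integrableOn_Ioc_of_le ht).2 (hGi _ ht)) h
  have h2 : ∫ r in T..max T t, ‖G r‖ = ∫ r in T..max T t, G r := by
    refine intervalIntegral.integral_congr_ae_restrict ?_
    rw [uIoc_of_le ht]
    filter_upwards [ae_restrict_of_ae_restrict_of_subset (fun r hr => hr.1.le) hG0] with r hr
    exact Real.norm_of_nonneg hr
  rw [h2]
  linarith [hM _ ht]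

theorem exists_tendsto_of_antitoneOn {F : ℝ → ℝ} {T M : ℝ} (hF : AntitoneOn F (Ici T))
    (hM : ∀ t, T ≤ t → M ≤ F t) : ∃ l, Tendsto F atTop (𝓝 l) := by
  have h1 : Antitone fun t => F (max T t) := fun s t hst =>
    hF (mem_Ici.2 (le_max_left _ _)) (mem_Ici.2 (le_max_left _ _)) (max_le_max le_rfl hst)
  refine ⟨_, (tendsto_atTop_ciInf h1 ⟨M, ?_⟩).congr' ?_⟩
  · rintro _ ⟨t, rfl⟩
    exact hM _ (le_max_left _ _)
  · filter_upwards [eventually_ge_atTop T] with t ht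
    rw [max_eq_right ht]

/-- V minus the integral of R is nonincreasing and bounded below, and the integral itself converges.
-/
theorem LocallyAC.exists_tendsto_of_deriv_le {V R : ℝ → ℝ} (hV : LocallyAC V) {T M : ℝ}
    (hT : 0 ≤ T) (hM : ∀ t, T ≤ t → M ≤ V t) (hR : IntegrableOn R (Ici T))
    (h : ∀ᵐ r ∂(volume.restrict (Ici T)), deriv V r ≤ R r) : ∃ l, Tendsto V atTop (𝓝 l) := by
  have hRi : ∀ s t, T ≤ s → s ≤ t → IntervalIntegrable R volume s t := fun s t hs hst =>
    (intervalIntegrable_iff_integrableOn_Icc_of_le hst).2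
      (hR.mono_set fun r hr => hs.trans hr.1)
  have hlim : Tendsto (fun t => ∫ r in T..t, R r) atTop (𝓝 (∫ r in Ioi T, R r)) :=
    intervalIntegral_tendsto_integral_Ioi T (hR.mono_set Ioi_subset_Ici_self) tendsto_id
  have hanti : AntitoneOn (fun t => V t - ∫ r in T..t, R r) (Ici T) := by
    intro s hs t ht hst
    have h1 : ∫ r in s..t, deriv V r ≤ ∫ r in s..t, R r :=
      intervalIntegral.integral_mono_ae_restrict hst
        (hV.intervalIntegrable_deriv (hT.trans hs) hst) (hRi s t hs hst)
        (ae_restrict_of_ae_restrict_of_subset (fun r hr => le_trans hs hr.1) h)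
    rw [hV.integral_deriv (hT.trans hs) hst] at h1
    have h2 := intervalIntegral.integral_add_adjacent_intervals (hRi T s le_rfl hs)
      (hRi s t hs hst)
    simp only
    linarith
  obtain ⟨l, hl⟩ := exists_tendsto_of_antitoneOn (M := M - ∫ r in Ici T, |R r|) hanti
    (fun t ht => by
      have h2 : ∫ r in T..t, R r ≤ ∫ r in T..t, |R r| :=
        intervalIntegral.integral_mono_on ht (hRi T t le_rfl ht) (hRi T t le_rfl ht).abs
          fun r _ => le_abs_self _
      have h3 : ∫ r in T..t, |R r| ≤ ∫ r in Ici T, |R r| := by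
        rw [intervalIntegral.integral_of_le ht]
        refine setIntegral_mono_set hR.abs (Eventually.of_forall fun r => abs_nonneg _)
          (LE.le.eventuallyLE fun r hr => hr.1.le)
      linarith [hM t ht])
  exact ⟨_, (hl.add hlim).congr fun t => by ring⟩

/-- If `φ` converges and `w φ` is integrable for a nonnegative non-integrable weight `w`, then `φ`
tends to zero. -/
theorem tendsto_zero_of_integrableOn_mul {w φ : ℝ → ℝ} {l : ℝ} (hw : ContinuousOn w (Ici 0))
    (hw0 : ∀ t, 0 ≤ t → 0 ≤ w t) (hwi : ¬ IntegrableOn w (Ici 0)) (hφ : Tendsto φ atTop (𝓝 l))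
    (hi : ∃ T, IntegrableOn (fun t => w t * φ t) (Ici T)) : l = 0 := by
  by_contra hl
  obtain ⟨T₀, hi⟩ := hi
  have hl' : 0 < |l| := abs_pos.2 hl
  obtain ⟨T, hT⟩ := eventually_atTop.1
    (((hφ.abs.eventually (lt_mem_nhds (half_lt_self hl'))).and
      (eventually_ge_atTop T₀)).and (eventually_ge_atTop 0))
  have hT0 : 0 ≤ T := (hT T le_rfl).2
  apply hwi
  rw [← Icc_union_Ici_eq_Ici hT0]
  refine IntegrableOn.union ((hw.mono Icc_subset_Ici_self).integrableOn_Icc) ?_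
  have hi' : IntegrableOn (fun t => w t * φ t) (Ici T) :=
    hi.mono_set (Ici_subset_Ici.2 (hT T le_rfl).1.2)
  refine Integrable.mono' (hi'.norm.const_mul (2 / |l|))
    ((hw.mono (Ici_subset_Ici.2 hT0)).aestronglyMeasurable measurableSet_Ici) ?_
  filter_upwards [self_mem_ae_restrict measurableSet_Ici] with t ht
  have h1 := (hT t ht).1.1
  have h2 := hw0 t (hT0.trans ht)
  rw [Real.norm_of_nonneg h2, norm_mul, Real.norm_of_nonneg h2, Real.norm_eq_abs]
  rw [div_mul_eq_mul_div, le_div_iff₀ hl']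
  nlinarith

theorem not_integrableOn_one_Ici : ¬ IntegrableOn (fun _ : ℝ => (1 : ℝ)) (Ici 0) := by
  rw [integrableOn_const_iff]
  simp

/-- Integrability of φ' gives φ a limit; integrability of φ forces that limit to vanish. -/
theorem LocallyAC.tendsto_zero {φ : ℝ → ℝ} (hφ : LocallyAC φ)
    (hi : IntegrableOn φ (Ici 0)) (hi' : IntegrableOn (deriv φ) (Ici 0)) :
    Tendsto φ atTop (𝓝 0) := by
  have hlim : Tendsto (fun t => φ 0 + ∫ r in (0 : ℝ)..t, deriv φ r) atTop
      (𝓝 (φ 0 + ∫ r in Ioi 0, deriv φ r)) :=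
    (intervalIntegral_tendsto_integral_Ioi 0 (hi'.mono_set Ioi_subset_Ici_self)
      tendsto_id).const_add _
  have hlim' := hlim.congr' (f₂ := φ) (by
    filter_upwards [eventually_ge_atTop 0] with t ht
    rw [hφ.integral_deriv le_rfl ht]; ring)
  have h0 := tendsto_zero_of_integrableOn_mul (w := fun _ => 1) continuousOn_const
    (fun _ _ => zero_le_one) not_integrableOn_one_Ici hlim' ⟨0, by simpa using hi⟩
  rwa [h0] at hlim'

theorem intervalIntegrable_of_continuousOn_Ici {E : Type*} [NormedAddCommGroup E] {φ : ℝ → E}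
    (h : ContinuousOn φ (Ici 0)) {s t : ℝ} (hs : 0 ≤ s) (ht : 0 ≤ t) :
    IntervalIntegrable φ volume s t :=
  (h.mono fun _ hr => (le_min hs ht).trans hr.1).intervalIntegrable

theorem tendsto_integral_atTop_of_not_integrableOn {w : ℝ → ℝ} (hw : ContinuousOn w (Ici 0))
    (hw0 : ∀ t, 0 ≤ t → 0 ≤ w t) (hwi : ¬ IntegrableOn w (Ici 0)) :
    Tendsto (fun t => ∫ s in (0 : ℝ)..t, w s) atTop atTop := by
  by_contra hcon
  apply hwi
  have hmono : ∀ s t, 0 ≤ s → s ≤ t → ∫ r in (0 : ℝ)..s, w r ≤ ∫ r in (0 : ℝ)..t, w r := by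
    intro s t hs hst
    rw [← intervalIntegral.integral_add_adjacent_intervals
      (intervalIntegrable_of_continuousOn_Ici hw le_rfl hs)
      (intervalIntegrable_of_continuousOn_Ici hw hs (hs.trans hst))]
    have := intervalIntegral.integral_nonneg hst (μ := volume)
      fun r (hr : r ∈ Icc s t) => hw0 r (hs.trans hr.1)
    linarith
  have hb : ∃ I, ∀ t, 0 ≤ t → ∫ s in (0 : ℝ)..t, w s ≤ I := by
    by_contra! h
    apply hcon
    refine tendsto_atTop.2 fun b => ?_
    obtain ⟨s, hs, hb⟩ := h b
    filter_upwards [eventually_ge_atTop s] with t ht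
    exact hb.le.trans (hmono s t hs ht)
  obtain ⟨I, hI⟩ := hb
  rw [integrableOn_Ici_iff_integrableOn_Ioi]
  refine integrableOn_Ioi_of_intervalIntegral_norm_bounded I 0 (b := fun t : ℝ => t) (l := atTop)
    (fun t => ?_) tendsto_id ?_
  · exact (hw.mono Icc_subset_Ici_self).integrableOn_Icc.mono_set Ioc_subset_Icc_self
  · filter_upwards [eventually_ge_atTop 0] with t ht
    refine le_of_eq_of_le (intervalIntegral.integral_congr fun r hr => ?_) (hI t ht)
    rw [uIcc_of_le ht] at hr
    exact Real.norm_of_nonneg (hw0 r hr.1)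

/-- Weighted averages of a convergent function converge to the same limit. -/
theorem tendsto_weighted_average {w φ : ℝ → ℝ} {l : ℝ} (hw : ContinuousOn w (Ici 0))
    (hw0 : ∀ t, 0 ≤ t → 0 ≤ w t) (hwi : ¬ IntegrableOn w (Ici 0)) (hφc : ContinuousOn φ (Ici 0))
    (hφ : Tendsto φ atTop (𝓝 l)) :
    Tendsto (fun t => (∫ s in (0 : ℝ)..t, w s)⁻¹ * ∫ s in (0 : ℝ)..t, w s * φ s) atTop (𝓝 l) := by
  have hW := tendsto_integral_atTop_of_not_integrableOn hw hw0 hwi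
  rw [Metric.tendsto_atTop] at hφ
  rw [Metric.tendsto_nhds]
  intro ε hε
  obtain ⟨T', hT'⟩ := hφ (ε / 2) (half_pos hε)
  set T := max T' 0
  have hT0 : 0 ≤ T := le_max_right _ _
  have hT : ∀ t, T ≤ t → |φ t - l| ≤ ε / 2 := fun t ht => (hT' t ((le_max_left _ _).trans ht)).le
  -- Split the integral at T: the head is the constant A, eventually below W ε / 2, and the tail is
  -- at most W ε / 2.
  set A := ∫ s in (0 : ℝ)..T, w s * |φ s - l| with hA
  have hcd : ContinuousOn (fun s => w s * |φ s - l|) (Ici 0) :=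
    hw.mul (hφc.sub continuousOn_const).abs
  filter_upwards [hW.eventually_gt_atTop 0, hW.eventually_gt_atTop (2 * A / ε),
    eventually_ge_atTop T] with t h0 hAt ht
  have ht0 := hT0.trans ht
  set W := ∫ s in (0 : ℝ)..t, w s with hWdef
  have h1 : ∫ s in (0 : ℝ)..t, w s * (φ s - l) = (∫ s in (0 : ℝ)..t, w s * φ s) - W * l := by
    rw [hWdef, ← intervalIntegral.integral_mul_const, ← intervalIntegral.integral_sub]
    · simp_rw [mul_sub]
    · exact intervalIntegrable_of_continuousOn_Ici (hw.mul hφc) le_rfl ht0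
    · exact intervalIntegrable_of_continuousOn_Ici (hw.mul continuousOn_const) le_rfl ht0
  have h2 : |∫ s in (0 : ℝ)..t, w s * (φ s - l)| ≤ ∫ s in (0 : ℝ)..t, w s * |φ s - l| := by
    refine (intervalIntegral.abs_integral_le_integral_abs ht0).trans
      (le_of_eq (intervalIntegral.integral_congr fun r hr => ?_))
    rw [uIcc_of_le ht0] at hr
    simp only [abs_mul, abs_of_nonneg (hw0 r hr.1)]
  have h3 : ∫ s in T..t, w s * |φ s - l| ≤ ∫ s in T..t, w s * (ε / 2) := by
    refine intervalIntegral.integral_mono_on ht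
      (intervalIntegrable_of_continuousOn_Ici hcd hT0 ht0)
      (intervalIntegrable_of_continuousOn_Ici (hw.mul continuousOn_const) hT0 ht0) fun r hr => ?_
    exact mul_le_mul_of_nonneg_left (hT r hr.1) (hw0 r (hT0.trans hr.1))
  have h4 := intervalIntegral.integral_add_adjacent_intervals
    (intervalIntegrable_of_continuousOn_Ici hcd le_rfl hT0)
    (intervalIntegrable_of_continuousOn_Ici hcd hT0 ht0)
  have h5 := intervalIntegral.integral_add_adjacent_intervals
    (intervalIntegrable_of_continuousOn_Ici hw le_rfl hT0)
    (intervalIntegrable_of_continuousOn_Ici hw hT0 ht0)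
  have h6 := intervalIntegral.integral_nonneg hT0 (μ := volume)
    fun r (hr : r ∈ Icc 0 T) => hw0 r hr.1
  rw [intervalIntegral.integral_mul_const] at h3
  have h7 : A < W * (ε / 2) := by
    rw [div_lt_iff₀ hε] at hAt
    linarith
  rw [Real.dist_eq]
  have h8 : W⁻¹ * (∫ s in (0 : ℝ)..t, w s * φ s) - l =
      W⁻¹ * ∫ s in (0 : ℝ)..t, w s * (φ s - l) := by
    rw [h1]; field_simp
  rw [h8, abs_mul, abs_of_pos (inv_pos.2 h0), inv_mul_lt_iff₀ h0]
  nlinarith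

/-- The derivative is an almost everywhere limit of continuous forward difference quotients. Forward
steps stay in the half-line, and no separability of the space is needed. -/
theorem aestronglyMeasurable_derivWithin_of_continuousOn {E : Type*} [NormedAddCommGroup E]
    [NormedSpace ℝ E] {v : ℝ → E} (hv : ContinuousOn v (Ici 0))
    (hd : ∀ᵐ t ∂(volume.restrict (Ici (0 : ℝ))), DifferentiableWithinAt ℝ v (Ici 0) t) :
    AEStronglyMeasurable (derivWithin v (Ici 0)) (volume.restrict (Ici 0)) := by
  have hc : ∀ n : ℕ, 0 < 1 / ((n : ℝ) + 1) := fun n => by positivity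
  refine aestronglyMeasurable_of_tendsto_ae atTop
    (f := fun (n : ℕ) t => slope v t (t + 1 / ((n : ℝ) + 1))) (fun n => ?_) ?_
  · refine ContinuousOn.aestronglyMeasurable ?_ measurableSet_Ici
    have h1 : ContinuousOn (fun t => v (t + 1 / ((n : ℝ) + 1))) (Ici 0) :=
      hv.comp (by fun_prop) fun t ht => add_nonneg (mem_Ici.1 ht) (hc n).le
    refine ((h1.sub hv).const_smul (1 / ((n : ℝ) + 1))⁻¹).congr fun t _ => ?_
    simp [slope]
  · filter_upwards [hd, self_mem_ae_restrict measurableSet_Ici] with t ht ht0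
    refine (hasDerivWithinAt_iff_tendsto_slope.1 ht.hasDerivWithinAt).comp ?_
    refine tendsto_nhdsWithin_iff.2 ⟨?_, Eventually.of_forall fun n => ⟨?_, ?_⟩⟩
    · simpa using tendsto_one_div_add_atTop_nhds_zero_nat.const_add t
    · exact add_nonneg (mem_Ici.1 ht0) (hc n).le
    · simpa using (hc n).ne'

end AbsoluteContinuity

/-! ### Weak compactness and Opial's argument. -/

section WeakConvergence

variable {H : Type*} [NormedAddCommGroup H] [InnerProductSpace ℝ H] [CompleteSpace H]

/-- Banach–Alaoglu, transported through the Riesz isometry; ultrafilters replace the extraction of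
subsequences. -/
theorem exists_weak_limit_ultrafilter {ι : Type*} {U : Ultrafilter ι} {X : ι → H} {K : ℝ}
    (hX : ∀ᶠ i in (U : Filter ι), ‖X i‖ ≤ K) :
    ∃ z : H, ∀ h, Tendsto (fun i => ⟪X i, h⟫_ℝ) U (𝓝 ⟪z, h⟫_ℝ) := by
  let D : ι → WeakDual ℝ H := fun i => StrongDual.toWeakDual (InnerProductSpace.toDual ℝ H (X i))
  have hcomp := WeakDual.isCompact_closedBall (𝕜 := ℝ) (E := H) 0 K
  obtain ⟨d, -, hd⟩ := hcomp.ultrafilter_le_nhds (U.map D) (by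
    rw [le_principal_iff, Ultrafilter.mem_coe, Ultrafilter.mem_map]
    refine mem_of_superset hX fun i hi => ?_
    change InnerProductSpace.toDual ℝ H (X i) ∈ Metric.closedBall 0 K
    simpa using hi)
  refine ⟨(InnerProductSpace.toDual ℝ H).symm (WeakDual.toStrongDual d), fun h => ?_⟩
  have := ((WeakDual.eval_continuous h).tendsto d).comp (show Tendsto D U (𝓝 d) from hd)
  rw [InnerProductSpace.toDual_symm_apply]
  exact this

theorem tendsto_toWeakSpace {ι : Type*} {l : Filter ι} {X : ι → H} {z : H}
    (h : ∀ h, Tendsto (fun i => ⟪X i, h⟫_ℝ) l (𝓝 ⟪z, h⟫_ℝ)) :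
    Tendsto (fun i => toWeakSpace ℝ H (X i)) l (𝓝 (toWeakSpace ℝ H z)) := by
  have hind : IsInducing fun (x : WeakSpace ℝ H) (φ : H →L[ℝ] ℝ) =>
    (topDualPairing ℝ H).flip x φ := ⟨rfl⟩
  refine hind.tendsto_nhds_iff.2 (tendsto_pi_nhds.2 fun φ => ?_)
  have e : ∀ y : H, (topDualPairing ℝ H).flip (toWeakSpace ℝ H y) φ =
      ⟪y, (InnerProductSpace.toDual ℝ H).symm φ⟫_ℝ := fun y => by
    rw [real_inner_comm, InnerProductSpace.toDual_symm_apply]; rfl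
  simp only [Function.comp_def, e]
  exact h _

/-- A variant of Opial's lemma. -/
theorem exists_tendsto_toWeakSpace {ι : Type*} {l : Filter ι} [l.NeBot] {X : ι → H} {K : ℝ}
    {Z : Set H} (hX : ∀ᶠ i in l, ‖X i‖ ≤ K)
    (hcl : ∀ U : Ultrafilter ι, ↑U ≤ l → ∀ z,
      (∀ h, Tendsto (fun i => ⟪X i, h⟫_ℝ) U (𝓝 ⟪z, h⟫_ℝ)) → z ∈ Z)
    (hZ : ∀ z₁ ∈ Z, ∀ z₂ ∈ Z, ∃ c, Tendsto (fun i => ⟪X i, z₁ - z₂⟫_ℝ) l (𝓝 c)) :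
    ∃ z ∈ Z, Tendsto (fun i => toWeakSpace ℝ H (X i)) l (𝓝 (toWeakSpace ℝ H z)) := by
  have hex : ∀ U : Ultrafilter ι, ↑U ≤ l → ∃ z ∈ Z,
      ∀ h, Tendsto (fun i => ⟪X i, h⟫_ℝ) U (𝓝 ⟪z, h⟫_ℝ) := fun U hU => by
    obtain ⟨z, hz⟩ := exists_weak_limit_ultrafilter (hX.filter_mono hU)
    exact ⟨z, hcl U hU z hz, hz⟩
  obtain ⟨z, hzZ, hz⟩ := hex (Ultrafilter.of l) (Ultrafilter.of_le l)
  refine ⟨z, hzZ, tendsto_toWeakSpace fun h => ?_⟩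
  rw [tendsto_iff_ultrafilter]
  intro U hU
  obtain ⟨y, hyZ, hy⟩ := hex U hU
  -- Both ultrafilters see the same limit of ⟪X, z - y⟫, so ⟪z, z - y⟫ = ⟪y, z - y⟫ and z = y.
  obtain ⟨c, hc⟩ := hZ z hzZ y hyZ
  have h1 := tendsto_nhds_unique (hz (z - y)) (hc.mono_left (Ultrafilter.of_le l))
  have h2 := tendsto_nhds_unique (hy (z - y)) (hc.mono_left hU)
  have h3 : ⟪z - y, z - y⟫_ℝ = 0 := by rw [inner_sub_left, h1, h2, sub_self]
  rw [sub_eq_zero.1 (inner_self_eq_zero.1 h3)]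
  exact hy h

end WeakConvergence

end Bilevel

namespace Bilevel

/-! ### Pointwise consequences of the monotonicity inequality. -/

section Pointwise

variable {H : Type*} [NormedAddCommGroup H] [InnerProductSpace ℝ H]

/-- The pointwise estimate behind the energy inequality. -/
theorem sq_norm_add_inner_le {e X b d k p : H} {l s Lψ Lg μ ψx : ℝ} (hl : 0 < l) (hs : 0 < s)
    (hmono : μ * ‖e + X‖ ^ 2 ≤ ⟪e + X, -(l⁻¹ • e) - s • b - d - k⟫_ℝ)
    (hb : ‖b‖ ^ 2 ≤ Lψ * ⟪X, b⟫_ℝ) (hb0 : 0 ≤ ⟪X, b⟫_ℝ) (hψ : ψx ≤ ⟪X, b⟫_ℝ)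
    (hd : ‖d‖ ^ 2 ≤ Lg * ⟪X, d⟫_ℝ) (hd0 : 0 ≤ ⟪X, d⟫_ℝ)
    (hψs : l * s * Lψ ≤ 1) (hgs : l * Lg ≤ 1 / 6) :
    7 / 12 * ‖e‖ ^ 2 + ⟪X, e⟫_ℝ + 1 / 8 * (l * s * ⟪X, b⟫_ℝ) + μ * (l * ‖e + X‖ ^ 2)
      + l * ⟪X, k + p⟫_ℝ ≤ 6 * l ^ 2 * ‖k‖ ^ 2 + l * max 0 (⟪X, p⟫_ℝ - 1 / 8 * (s * ψx)) := by
  have h1 := mul_le_mul_of_nonneg_left hmono hl.le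
  have h2 : l * ⟪e + X, -(l⁻¹ • e) - s • b - d - k⟫_ℝ = -‖e‖ ^ 2 - ⟪X, e⟫_ℝ
      - l * s * ⟪e, b⟫_ℝ - l * s * ⟪X, b⟫_ℝ - l * ⟪e, d⟫_ℝ - l * ⟪X, d⟫_ℝ - l * ⟪e, k⟫_ℝ
      - l * ⟪X, k⟫_ℝ := by
    simp only [inner_add_left, inner_sub_right, inner_neg_right, inner_smul_right,
      real_inner_self_eq_norm_sq]
    field_simp
    ring
  have hls := mul_pos hl hs
  -- Budget for the three Young inequalities: the shares 1/3 + 1/24 + 1/24 of ‖e‖² leave 7/12. Of l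
  -- s⟪X, b⟫, 3/4 is spent here, 1/8 goes to the penalty term with p, and 1/8 survives in the
  -- conclusion.
  have ha : -(l * s * ⟪e, b⟫_ℝ) ≤ 1 / 3 * ‖e‖ ^ 2 + 3 / 4 * (l * s * ⟪X, b⟫_ℝ) := by
    have h3 := neg_le_of_abs_le (abs_real_inner_le_norm e b)
    have h4 : (l * s) ^ 2 * ‖b‖ ^ 2 ≤ l * s * ⟪X, b⟫_ℝ := by
      have h5 := mul_le_mul_of_nonneg_left hb (sq_nonneg (l * s))
      have h6 := mul_le_mul_of_nonneg_right hψs (mul_nonneg hls.le hb0)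
      linarith
    nlinarith [sq_nonneg (‖e‖ - 3 / 2 * (l * s * ‖b‖)), mul_le_mul_of_nonneg_left h3 hls.le]
  have hbd : -(l * ⟪e, d⟫_ℝ) ≤ 1 / 24 * ‖e‖ ^ 2 + l * ⟪X, d⟫_ℝ := by
    have h3 := neg_le_of_abs_le (abs_real_inner_le_norm e d)
    have h4 : 6 * (l ^ 2 * ‖d‖ ^ 2) ≤ l * ⟪X, d⟫_ℝ := by
      have h5 := mul_le_mul_of_nonneg_left hd (sq_nonneg l)
      have h6 := mul_le_mul_of_nonneg_right hgs (mul_nonneg hl.le hd0)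
      linarith
    nlinarith [sq_nonneg (‖e‖ - 12 * (l * ‖d‖)), mul_le_mul_of_nonneg_left h3 hl.le]
  have hk : -(l * ⟪e, k⟫_ℝ) ≤ 1 / 24 * ‖e‖ ^ 2 + 6 * l ^ 2 * ‖k‖ ^ 2 := by
    have h3 := neg_le_of_abs_le (abs_real_inner_le_norm e k)
    nlinarith [sq_nonneg (‖e‖ - 12 * (l * ‖k‖)), mul_le_mul_of_nonneg_left h3 hl.le]
  have hp : l * ⟪X, p⟫_ℝ - 1 / 8 * (l * s * ⟪X, b⟫_ℝ) ≤
      l * max 0 (⟪X, p⟫_ℝ - 1 / 8 * (s * ψx)) := by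
    have h3 := mul_le_mul_of_nonneg_left (le_max_right 0 (⟪X, p⟫_ℝ - 1 / 8 * (s * ψx))) hl.le
    have h4 := mul_le_mul_of_nonneg_left hψ hls.le
    linarith
  rw [inner_add_right]
  linarith

/-- A cruder bound on e that needs no small step sizes. It serves on [0, T], where the energy
inequality is unavailable. -/
theorem sq_norm_le_of_inner {e X b d k : H} {l s : ℝ} (hl : 0 < l) (hs : 0 < s)
    (hmono : 0 ≤ ⟪e + X, -(l⁻¹ • e) - s • b - d - k⟫_ℝ)
    (hb0 : 0 ≤ ⟪X, b⟫_ℝ) (hd0 : 0 ≤ ⟪X, d⟫_ℝ) :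
    ‖e‖ ^ 2 ≤ (‖X‖ + l * s * ‖b‖ + l * ‖d‖ + l * ‖k‖) ^ 2 + 2 * (l * ‖X‖ * ‖k‖) := by
  have h1 := mul_le_mul_of_nonneg_left hmono hl.le
  have h2 : l * ⟪e + X, -(l⁻¹ • e) - s • b - d - k⟫_ℝ = -‖e‖ ^ 2 - ⟪X, e⟫_ℝ
      - l * s * ⟪e, b⟫_ℝ - l * s * ⟪X, b⟫_ℝ - l * ⟪e, d⟫_ℝ - l * ⟪X, d⟫_ℝ - l * ⟪e, k⟫_ℝ
      - l * ⟪X, k⟫_ℝ := by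
    simp only [inner_add_left, inner_sub_right, inner_neg_right, inner_smul_right,
      real_inner_self_eq_norm_sq]
    field_simp
    ring
  have hls := mul_pos hl hs
  have h3 := neg_le_of_abs_le (abs_real_inner_le_norm X e)
  have h4 := mul_le_mul_of_nonneg_left (neg_le_of_abs_le (abs_real_inner_le_norm e b)) hls.le
  have h5 := mul_le_mul_of_nonneg_left (neg_le_of_abs_le (abs_real_inner_le_norm e d)) hl.le
  have h6 := mul_le_mul_of_nonneg_left (neg_le_of_abs_le (abs_real_inner_le_norm e k)) hl.le
  have h7 := mul_le_mul_of_nonneg_left (neg_le_of_abs_le (abs_real_inner_le_norm X k)) hl.le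
  have h8 := mul_nonneg hls.le hb0
  have h9 := mul_nonneg hl.le hd0
  set A := ‖X‖ + l * s * ‖b‖ + l * ‖d‖ + l * ‖k‖ with hA
  have h10 : ‖e‖ ^ 2 ≤ ‖e‖ * A + l * ‖X‖ * ‖k‖ := by
    rw [hA]
    linarith
  -- From ‖e‖² ≤ ‖e‖ A + r and ‖e‖ A ≤ (‖e‖² + A²) / 2 follows ‖e‖² ≤ A² + 2 r.
  nlinarith [sq_nonneg (‖e‖ - A)]

theorem IsProperConvexLsc.monotone_subdiff {f : H → EReal} (h : IsProperConvexLsc f) : ∀ x y u v : H, u ∈ subdiff f x →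
    v ∈ subdiff f y → 0 * ‖x - y‖ ^ 2 ≤ ⟪x - y, u - v⟫_ℝ := fun x y u v hu hv => by
  rw [zero_mul]; exact isMonotoneOp_subdiff h x y u v hu hv

end Pointwise

/-! ### The energy inequality and boundedness of the trajectory. -/

section Energy

variable {H : Type*} [NormedAddCommGroup H] [InnerProductSpace ℝ H]

/-- The Lyapunov function of the dynamical system, relative to the point `u`. -/
noncomputable def energy (γ : ℝ → ℝ) (x : ℝ → H) (u : H) (t : ℝ) : ℝ :=
  ⟪x t - u, velocity x t⟫_ℝ + γ t * (1 / 2 * ‖x t - u‖ ^ 2)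
    + 7 / 12 * (γ t * ‖velocity x t‖ ^ 2)

/-- The damped acceleration `x'' + γ x'`. -/
noncomputable def dampedAcceleration (γ : ℝ → ℝ) (x : ℝ → H) (t : ℝ) : H :=
  acceleration x t + γ t • velocity x t

/-- The properties of the trajectory and of the data which the energy method uses; from time `T` on
the step sizes are small. -/
structure EnergySetting [CompleteSpace H] (f : H → EReal) (g ψ : H → ℝ) (γ lam β : ℝ → ℝ)
    (x : ℝ → H) (Lg Lψ T : ℝ) : Prop where
  T_nonneg : 0 ≤ T
  lam_pos : ∀ t, 0 ≤ t → 0 < lam t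
  β_pos : ∀ t, 0 ≤ t → 0 < β t
  lam_cont : ContinuousOn lam (Ici 0)
  β_cont : ContinuousOn β (Ici 0)
  γ_ac : LocallyAC γ
  γ_deriv : ∀ᵐ t ∂(volume.restrict (Ici (0 : ℝ))), deriv γ t ≤ 0
  γ_ge : ∀ t, 0 ≤ t → √2 ≤ γ t
  gradient_g_cont : Continuous (gradient g)
  gradient_ψ_cont : Continuous (gradient ψ)
  cocoercive_g : ∀ y z, ‖gradient g y - gradient g z‖ ^ 2 ≤
    Lg * ⟪y - z, gradient g y - gradient g z⟫_ℝ
  cocoercive_ψ : ∀ y z, ‖gradient ψ y - gradient ψ z‖ ^ 2 ≤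
    Lψ * ⟪y - z, gradient ψ y - gradient ψ z⟫_ℝ
  Lg_pos : 0 < Lg
  Lψ_pos : 0 < Lψ
  ψ_le : ∀ y, ∀ u ∈ argmin ψ, ψ y ≤ ⟪y - u, gradient ψ y⟫_ℝ
  gradient_ψ_eq : ∀ u ∈ argmin ψ, gradient ψ u = 0
  step_ψ : ∀ t, T ≤ t → lam t * β t * Lψ ≤ 1
  step_g : ∀ t, T ≤ t → lam t * Lg ≤ 1 / 6
  lam_sq : IntegrableOn (fun t => lam t ^ 2) (Ici 0)
  fenchel : ∀ u, ∀ p ∈ normalCone (argmin ψ) u, IntegrableOn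
    (fun t => lam t * max 0 (⟪x t - u, p⟫_ℝ - 1 / 8 * (β t * ψ (x t)))) (Ici 0)
  x_ac : LocallyAC x
  velocity_ac : LocallyAC (velocity x)
  x_deriv : ∀ t, 0 < t → HasDerivAt x (velocity x t) t
  velocity_deriv : ∀ᵐ t ∂(volume.restrict (Ici (0 : ℝ))),
    HasDerivAt (velocity x) (acceleration x t) t
  acceleration_meas : AEStronglyMeasurable (acceleration x) (volume.restrict (Ici 0))
  subgradient : ∀ᵐ t ∂(volume.restrict (Ici (0 : ℝ))),
    -((lam t)⁻¹ • dampedAcceleration γ x t) - β t • gradient ψ (x t) - gradient g (x t) ∈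
      subdiff f (dampedAcceleration γ x t + x t)

namespace EnergySetting

variable [CompleteSpace H] {f : H → EReal} {g ψ : H → ℝ} {γ lam β : ℝ → ℝ} {x : ℝ → H}
  {Lg Lψ T : ℝ}

theorem γ_pos (h : EnergySetting f g ψ γ lam β x Lg Lψ T) {t : ℝ} (ht : 0 ≤ t) : 0 < γ t :=
  (Real.sqrt_pos.2 two_pos).trans_le (h.γ_ge t ht)

theorem γ_antitone (h : EnergySetting f g ψ γ lam β x Lg Lψ T) : AntitoneOn γ (Ici 0) :=
  h.γ_ac.antitoneOn h.γ_deriv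

theorem energy_ac (h : EnergySetting f g ψ γ lam β x Lg Lψ T) (u : H) :
    LocallyAC (energy γ x u) :=
  (((h.x_ac.sub_const u).inner h.velocity_ac).fun_add
    (h.γ_ac.fun_mul ((h.x_ac.sub_const u).norm_sq.const_mul (1 / 2)))).fun_add
    ((h.γ_ac.fun_mul h.velocity_ac.norm_sq).const_mul (7 / 12))

theorem ae_pos : ∀ᵐ t ∂(volume.restrict (Ici (0 : ℝ))), 0 < t := by
  rw [← restrict_Ioi_eq_restrict_Ici]
  exact self_mem_ae_restrict measurableSet_Ioi

/-- The weight 7/12 matches the coefficient of ‖e‖² in `sq_norm_add_inner_le`. Expanding ‖x'' + γ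
x'‖² turns the derivative of the last energy term into squares; the coefficient of ‖x'‖² becomes 1 -
7/12 γ² ≤ -1/6 since γ² ≥ 2, and γ' ≤ 0 discards the rest. -/
theorem deriv_energy_le (h : EnergySetting f g ψ γ lam β x Lg Lψ T) (u : H) :
    ∀ᵐ t ∂(volume.restrict (Ici (0 : ℝ))), deriv (energy γ x u) t ≤
      ⟪x t - u, dampedAcceleration γ x t⟫_ℝ + 7 / 12 * ‖dampedAcceleration γ x t‖ ^ 2
      - 7 / 12 * ‖acceleration x t‖ ^ 2 - 1 / 6 * ‖velocity x t‖ ^ 2 := by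
  filter_upwards [ae_pos, h.γ_ac.ae_differentiableAt, h.γ_deriv, h.velocity_deriv]
    with t ht hγd hγ0 hv
  have hγ := hγd.hasDerivAt
  have hX := (h.x_deriv t ht).sub_const u
  have h1 := (hX.inner ℝ hv).add (hγ.mul (hX.norm_sq.const_mul (1 / 2)))
  have h2 := h1.add ((hγ.mul hv.norm_sq).const_mul (7 / 12))
  have h3 : deriv (energy γ x u) t = _ := h2.deriv
  rw [h3]
  have hγ2 : 2 ≤ γ t ^ 2 := by
    have := h.γ_ge t ht.le
    have h5 := pow_le_pow_left₀ (Real.sqrt_nonneg 2) this 2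
    rwa [Real.sq_sqrt two_pos.le] at h5
  have h4 : ‖dampedAcceleration γ x t‖ ^ 2 = ‖acceleration x t‖ ^ 2
      + 2 * γ t * ⟪velocity x t, acceleration x t⟫_ℝ + γ t ^ 2 * ‖velocity x t‖ ^ 2 := by
    rw [dampedAcceleration, norm_add_sq_real, inner_smul_right, norm_smul, mul_pow,
      Real.norm_eq_abs, sq_abs, real_inner_comm]
    ring
  have h5 : ⟪x t - u, dampedAcceleration γ x t⟫_ℝ =
      ⟪x t - u, acceleration x t⟫_ℝ + γ t * ⟪x t - u, velocity x t⟫_ℝ := by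
    rw [dampedAcceleration, inner_add_right, inner_smul_right]
  rw [h4, h5, real_inner_self_eq_norm_sq]
  have h6 : deriv γ t * (1 / 2 * ‖x t - u‖ ^ 2) ≤ 0 :=
    mul_nonpos_of_nonpos_of_nonneg hγ0 (by positivity)
  have h7 : deriv γ t * ‖velocity x t‖ ^ 2 ≤ 0 :=
    mul_nonpos_of_nonpos_of_nonneg hγ0 (by positivity)
  have h8 := mul_le_mul_of_nonneg_right hγ2 (sq_nonneg ‖velocity x t‖)
  linarith

/-- The integrable right-hand side of the energy inequality. -/
noncomputable def remainder (g ψ : H → ℝ) (lam β : ℝ → ℝ) (x : ℝ → H) (u v p : H) (t : ℝ) : ℝ :=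
  6 * lam t ^ 2 * ‖gradient g u + v‖ ^ 2 +
    lam t * max 0 (⟪x t - u, p⟫_ℝ - 1 / 8 * (β t * ψ (x t)))

theorem remainder_integrable (h : EnergySetting f g ψ γ lam β x Lg Lψ T) {u v p : H}
    (hp : p ∈ normalCone (argmin ψ) u) : IntegrableOn (remainder g ψ lam β x u v p) (Ici T) :=
  IntegrableOn.mono_set
    (((h.lam_sq.const_mul 6).mul_const (‖gradient g u + v‖ ^ 2)).add (h.fenchel u p hp))
    (Ici_subset_Ici.2 h.T_nonneg)

theorem inner_gradient_nonneg (h : EnergySetting f g ψ γ lam β x Lg Lψ T) {u : H}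
    (hu : u ∈ argmin ψ) (y : H) : 0 ≤ ⟪y - u, gradient ψ y⟫_ℝ := by
  have := h.cocoercive_ψ y u
  rw [h.gradient_ψ_eq u hu, sub_zero] at this
  exact nonneg_of_mul_nonneg_right ((sq_nonneg _).trans this) h.Lψ_pos

theorem inner_gradient_sub_nonneg (h : EnergySetting f g ψ γ lam β x Lg Lψ T) (y u : H) :
    0 ≤ ⟪y - u, gradient g y - gradient g u⟫_ℝ :=
  nonneg_of_mul_nonneg_right ((sq_nonneg _).trans (h.cocoercive_g y u)) h.Lg_pos

/-- The dissipated quantity. -/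
noncomputable def dissipation (ψ : H → ℝ) (γ lam β : ℝ → ℝ) (x : ℝ → H) (μ : ℝ) (u : H) (t : ℝ) :
    ℝ :=
  7 / 12 * ‖acceleration x t‖ ^ 2 + 1 / 6 * ‖velocity x t‖ ^ 2
    + 1 / 8 * (lam t * β t * ⟪gradient ψ (x t), x t - u⟫_ℝ)
    + μ * (lam t * ‖dampedAcceleration γ x t + (x t - u)‖ ^ 2)

/-- The gradient of g is centered at u so that its increment is cocoercive; the constant ∇g(u) + v
enters the remainder only through λ²‖∇g(u) + v‖². -/
theorem ae_inner_subgradient (h : EnergySetting f g ψ γ lam β x Lg Lψ T) {μ : ℝ}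
    (hμ : ∀ x y u v : H, u ∈ subdiff f x → v ∈ subdiff f y → μ * ‖x - y‖ ^ 2 ≤ ⟪x - y, u - v⟫_ℝ)
    {u v : H} (hv : v ∈ subdiff f u) : ∀ᵐ t ∂(volume.restrict (Ici (0 : ℝ))),
    μ * ‖dampedAcceleration γ x t + (x t - u)‖ ^ 2 ≤
      ⟪dampedAcceleration γ x t + (x t - u), -((lam t)⁻¹ • dampedAcceleration γ x t)
        - β t • gradient ψ (x t) - (gradient g (x t) - gradient g u) - (gradient g u + v)⟫_ℝ := by
  filter_upwards [h.subgradient] with t ht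
  have h1 := hμ _ _ _ _ ht hv
  rw [add_sub_assoc] at h1
  refine h1.trans (le_of_eq ?_)
  congr 1
  abel

theorem ae_deriv_energy_add_le (h : EnergySetting f g ψ γ lam β x Lg Lψ T) {μ : ℝ}
    (hμ : ∀ x y u v : H, u ∈ subdiff f x → v ∈ subdiff f y → μ * ‖x - y‖ ^ 2 ≤ ⟪x - y, u - v⟫_ℝ)
    {u v p : H} (hv : v ∈ subdiff f u) (hp : p ∈ normalCone (argmin ψ) u) :
    ∀ᵐ t ∂(volume.restrict (Ici T)), deriv (energy γ x u) t + dissipation ψ γ lam β x μ u t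
      + lam t * ⟪x t - u, v + gradient g u + p⟫_ℝ ≤ remainder g ψ lam β x u v p t := by
  have hsub : Ici T ⊆ Ici 0 := Ici_subset_Ici.2 h.T_nonneg
  filter_upwards [ae_restrict_of_ae_restrict_of_subset hsub (h.deriv_energy_le u),
    ae_restrict_of_ae_restrict_of_subset hsub (h.ae_inner_subgradient hμ hv),
    self_mem_ae_restrict measurableSet_Ici] with t h1 h2 ht
  have ht0 : 0 ≤ t := h.T_nonneg.trans ht
  have hc := h.cocoercive_ψ (x t) u
  rw [h.gradient_ψ_eq u hp.1, sub_zero] at hc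
  have h3 := sq_norm_add_inner_le (p := p) (h.lam_pos t ht0) (h.β_pos t ht0) h2 hc
    (h.inner_gradient_nonneg hp.1 _) (h.ψ_le _ _ hp.1) (h.cocoercive_g (x t) u)
    (h.inner_gradient_sub_nonneg _ _) (h.step_ψ t ht) (h.step_g t ht)
  rw [add_comm (gradient g u) v] at h3
  simp only [dissipation, remainder]
  rw [add_comm (gradient g u) v, real_inner_comm (x t - u) (gradient ψ (x t))]
  linarith

theorem dissipation_nonneg (h : EnergySetting f g ψ γ lam β x Lg Lψ T) {μ : ℝ} (hμ : 0 ≤ μ) {u : H}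
    (hu : u ∈ argmin ψ) {t : ℝ} (ht : 0 ≤ t) : 0 ≤ dissipation ψ γ lam β x μ u t := by
  have h1 := h.inner_gradient_nonneg hu (x t)
  rw [real_inner_comm] at h1
  have h2 := h.lam_pos t ht
  have h3 := h.β_pos t ht
  unfold dissipation
  positivity

/-- The trajectory and its velocity are bounded. -/
theorem exists_bound (h : EnergySetting f g ψ γ lam β x Lg Lψ T) (hf : IsProperConvexLsc f)
    {u v p : H} (hv : v ∈ subdiff f u) (hp : p ∈ normalCone (argmin ψ) u)
    (h0 : v + gradient g u + p = 0) :
    ∃ K, ∀ t, 0 ≤ t → ‖x t‖ ≤ K ∧ ‖velocity x t‖ ≤ K := by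
  set M := |energy γ x u T + ∫ r in Ici T, abs (remainder g ψ lam β x u v p r)| with hM
  have hM0 : 0 ≤ M := abs_nonneg _
  have hVM : ∀ t, T ≤ t → energy γ x u t ≤ M := fun t ht => by
    have h1 := (h.energy_ac u).integral_add_le (S := fun _ => 0) h.T_nonneg ht
      (h.remainder_integrable (v := v) hp) intervalIntegrable_const (by
        filter_upwards [h.ae_deriv_energy_add_le hf.monotone_subdiff hv hp,
          self_mem_ae_restrict measurableSet_Ici] with t h1 ht
        have := h.dissipation_nonneg le_rfl hp.1 (h.T_nonneg.trans ht)
        rw [h0, inner_zero_right, mul_zero] at h1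
        linarith)
    rw [intervalIntegral.integral_zero, add_zero] at h1
    exact h1.trans (le_abs_self _)
  have hγ1 : ∀ t, 0 ≤ t → 1 ≤ γ t := fun t ht =>
    (Real.one_lt_sqrt_two.le).trans (h.γ_ge t ht)
  -- With φ = ‖x - u‖² / 2, energy ≤ M and γ ≥ 1 give φ' + φ ≤ M, so eᵗ(φ - M) is nonincreasing.
  let F : ℝ → ℝ := fun t => Real.exp t * (1 / 2 * ‖x t - u‖ ^ 2 - M)
  have hF : ∀ t, 0 < t → HasDerivAt F (Real.exp t * (1 / 2 * ‖x t - u‖ ^ 2 - M)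
      + Real.exp t * (1 / 2 * (2 * ⟪x t - u, velocity x t⟫_ℝ))) t := fun t ht =>
    (Real.hasDerivAt_exp t).mul
      ((((h.x_deriv t ht).sub_const u).norm_sq.const_mul (1 / 2)).sub_const M)
  have hanti : AntitoneOn F (Ici T) := by
    refine antitoneOn_of_deriv_nonpos (convex_Ici T) ?_ ?_ ?_
    · exact Real.continuous_exp.continuousOn.mul (((((h.x_ac.continuousOn.mono
        (Ici_subset_Ici.2 h.T_nonneg)).sub continuousOn_const).norm.pow 2).const_mul
          (1 / 2)).sub continuousOn_const)
    · intro t ht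
      rw [interior_Ici] at ht
      exact (hF t (h.T_nonneg.trans_lt ht)).differentiableAt.differentiableWithinAt
    · intro t ht
      rw [interior_Ici] at ht
      have ht0 := h.T_nonneg.trans_lt ht
      rw [(hF t ht0).deriv, ← mul_add]
      refine mul_nonpos_of_nonneg_of_nonpos (Real.exp_pos t).le ?_
      have h1 := hVM t (le_of_lt ht)
      unfold energy at h1
      have h2 : 0 ≤ 7 / 12 * (γ t * ‖velocity x t‖ ^ 2) := by
        have := h.γ_pos ht0.le
        positivity
      have h3 := mul_le_mul_of_nonneg_right (hγ1 t ht0.le)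
        (show 0 ≤ 1 / 2 * ‖x t - u‖ ^ 2 by positivity)
      linarith
  set B := 1 / 2 * ‖x T - u‖ ^ 2 + M with hB
  have hxB : ∀ t, T ≤ t → 1 / 2 * ‖x t - u‖ ^ 2 ≤ B := fun t ht => by
    by_contra! hcon
    have h1 := hanti self_mem_Ici (mem_Ici.2 ht) ht
    have h2 : Real.exp T ≤ Real.exp t := Real.exp_le_exp.2 ht
    have h3 := Real.exp_pos T
    simp only [F] at h1
    have h5 : 0 ≤ 1 / 2 * ‖x T - u‖ ^ 2 := by positivity
    have h6 : 0 < 1 / 2 * ‖x t - u‖ ^ 2 - M - 1 / 2 * ‖x T - u‖ ^ 2 := by linarith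
    nlinarith [mul_le_mul_of_nonneg_right h2 h5, mul_pos h3 h6, Real.exp_pos t,
      mul_pos (Real.exp_pos t) h6, mul_nonneg h3.le hM0]
  have hB0 : 0 ≤ B := by positivity
  have hvB : ∀ t, T ≤ t → ‖velocity x t‖ ^ 2 ≤ 4 * M + 8 * B := fun t ht => by
    have ht0 := h.T_nonneg.trans ht
    have h1 := hVM t ht
    unfold energy at h1
    have h2 := neg_le_of_abs_le (abs_real_inner_le_norm (x t - u) (velocity x t))
    have h3 : 0 ≤ γ t * (1 / 2 * ‖x t - u‖ ^ 2) := by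
      have := h.γ_pos ht0
      positivity
    have h4 := mul_le_mul_of_nonneg_right (hγ1 t ht0) (sq_nonneg ‖velocity x t‖)
    nlinarith [hxB t ht, sq_nonneg (‖velocity x t‖ - 2 * ‖x t - u‖)]
  obtain ⟨K₁, hK₁⟩ := isCompact_Icc.exists_bound_of_continuousOn
    (h.x_ac.continuousOn.mono (Icc_subset_Ici_self : Icc 0 T ⊆ Ici 0))
  obtain ⟨K₂, hK₂⟩ := isCompact_Icc.exists_bound_of_continuousOn
    (h.velocity_ac.continuousOn.mono (Icc_subset_Ici_self : Icc 0 T ⊆ Ici 0))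
  refine ⟨max (max K₁ (√(2 * B) + ‖u‖)) (max K₂ (√(4 * M + 8 * B))), fun t ht => ?_⟩
  rcases le_total t T with htT | htT
  · exact ⟨(hK₁ t ⟨ht, htT⟩).trans ((le_max_left _ _).trans (le_max_left _ _)),
      (hK₂ t ⟨ht, htT⟩).trans ((le_max_left _ _).trans (le_max_right _ _))⟩
  · refine ⟨le_trans ?_ ((le_max_right _ _).trans (le_max_left _ _)),
      le_trans ?_ ((le_max_right _ _).trans (le_max_right _ _))⟩
    · have h1 : ‖x t - u‖ ≤ √(2 * B) := Real.le_sqrt_of_sq_le (by linarith [hxB t htT])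
      have h2 := norm_add_le (x t - u) u
      rw [sub_add_cancel] at h2
      linarith
    · exact Real.le_sqrt_of_sq_le (hvB t htT)

/-- Only the inner product in the energy can be negative. -/
theorem energy_bound (h : EnergySetting f g ψ γ lam β x Lg Lψ T) {K : ℝ}
    (hK : ∀ t, 0 ≤ t → ‖x t‖ ≤ K ∧ ‖velocity x t‖ ≤ K) (u : H) {t : ℝ} (ht : 0 ≤ t) :
    -((K + ‖u‖) * K) ≤ energy γ x u t := by
  obtain ⟨h1, h2⟩ := hK t ht
  have h3 := neg_le_of_abs_le (abs_real_inner_le_norm (x t - u) (velocity x t))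
  have h4 : ‖x t - u‖ ≤ K + ‖u‖ := (norm_sub_le _ _).trans (by linarith)
  have h5 : ‖x t - u‖ * ‖velocity x t‖ ≤ (K + ‖u‖) * K :=
    mul_le_mul h4 h2 (norm_nonneg _) ((norm_nonneg _).trans h4)
  have h6 := h.γ_pos ht
  have h7 : 0 ≤ γ t * (1 / 2 * ‖x t - u‖ ^ 2) := by positivity
  have h8 : 0 ≤ 7 / 12 * (γ t * ‖velocity x t‖ ^ 2) := by positivity
  unfold energy
  linarith

end EnergySetting

end Energy

end Bilevel

/-! ### Integrability and limits along the trajectory, relative to a point of Z. -/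

namespace Bilevel

namespace EnergySetting

variable {H : Type*} [NormedAddCommGroup H] [InnerProductSpace ℝ H]
  [CompleteSpace H] {f : H → EReal} {g ψ : H → ℝ} {γ lam β : ℝ → ℝ} {x : ℝ → H}
  {Lg Lψ T : ℝ}

theorem integrableOn_Ici_zero (h : EnergySetting f g ψ γ lam β x Lg Lψ T) {φ : ℝ → ℝ}
    (hφ : ContinuousOn φ (Ici 0)) (hi : IntegrableOn φ (Ici T)) : IntegrableOn φ (Ici 0) := by
  rw [← Icc_union_Ici_eq_Ici h.T_nonneg]
  exact (hφ.mono Icc_subset_Ici_self).integrableOn_Icc.union hi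

theorem gradient_ψ_inner_cont (h : EnergySetting f g ψ γ lam β x Lg Lψ T) (u : H) :
    ContinuousOn (fun t => lam t * β t * ⟪gradient ψ (x t), x t - u⟫_ℝ) (Ici 0) :=
  (h.lam_cont.mul h.β_cont).mul
    ((h.gradient_ψ_cont.comp_continuousOn h.x_ac.continuousOn).inner
      (h.x_ac.continuousOn.sub continuousOn_const))

theorem dampedAcceleration_meas (h : EnergySetting f g ψ γ lam β x Lg Lψ T) :
    AEStronglyMeasurable (dampedAcceleration γ x) (volume.restrict (Ici 0)) :=
  h.acceleration_meas.add ((h.γ_ac.continuousOn.smul h.velocity_ac.continuousOn).aestronglyMeasurable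
    measurableSet_Ici)

theorem lam_damped_meas (h : EnergySetting f g ψ γ lam β x Lg Lψ T) (u : H) :
    AEStronglyMeasurable (fun t => lam t * ‖dampedAcceleration γ x t + (x t - u)‖ ^ 2)
      (volume.restrict (Ici 0)) :=
  (h.lam_cont.aestronglyMeasurable measurableSet_Ici).mul
    ((h.dampedAcceleration_meas.add ((h.x_ac.sub_const u).continuousOn.aestronglyMeasurable
      measurableSet_Ici)).norm.pow 2)

theorem dissipation_integrable (h : EnergySetting f g ψ γ lam β x Lg Lψ T)
    (hf : IsProperConvexLsc f) {μ : ℝ} (hμ0 : 0 ≤ μ)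
    (hμ : ∀ x y u v : H, u ∈ subdiff f x → v ∈ subdiff f y → μ * ‖x - y‖ ^ 2 ≤ ⟪x - y, u - v⟫_ℝ)
    {u v p : H} (hv : v ∈ subdiff f u) (hp : p ∈ normalCone (argmin ψ) u)
    (h0 : v + gradient g u + p = 0) :
    IntegrableOn (dissipation ψ γ lam β x μ u) (Ici T) := by
  obtain ⟨K, hK⟩ := h.exists_bound hf hv hp h0
  refine (h.energy_ac u).integrableOn_of_deriv_add_le h.T_nonneg
    (fun t ht => h.energy_bound hK u (h.T_nonneg.trans ht))
    (h.remainder_integrable (v := v) hp) ?_ ?_ ?_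
  · have h1 : AEStronglyMeasurable (dissipation ψ γ lam β x μ u) (volume.restrict (Ici 0)) :=
      ((((h.acceleration_meas.norm.pow 2).const_mul (7 / 12)).add
        (((h.velocity_ac.continuousOn.aestronglyMeasurable
          measurableSet_Ici).norm.pow 2).const_mul (1 / 6))).add
        (((h.gradient_ψ_inner_cont u).aestronglyMeasurable measurableSet_Ici).const_mul
          (1 / 8))).add ((h.lam_damped_meas u).const_mul μ)
    exact h1.mono_set (Ici_subset_Ici.2 h.T_nonneg)
  · filter_upwards [self_mem_ae_restrict measurableSet_Ici] with t ht
    exact h.dissipation_nonneg hμ0 hp.1 (h.T_nonneg.trans ht)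
  · filter_upwards [h.ae_deriv_energy_add_le hμ hv hp] with t ht
    rwa [h0, inner_zero_right, mul_zero, add_zero] at ht

theorem integrableOn_of_le_dissipation {φ D : ℝ → ℝ} {c : ℝ} (hT : 0 ≤ T)
    (hφ : AEStronglyMeasurable φ (volume.restrict (Ici 0)))
    (hD : IntegrableOn D (Ici T)) (hle : ∀ t, T ≤ t → 0 ≤ φ t ∧ φ t ≤ c * D t) :
    IntegrableOn φ (Ici T) := by
  refine Integrable.mono' (hD.const_mul c) (hφ.mono_set (Ici_subset_Ici.2 hT)) ?_
  filter_upwards [self_mem_ae_restrict measurableSet_Ici] with t ht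
  rw [Real.norm_of_nonneg (hle t ht).1]
  exact (hle t ht).2

section Zero

variable {u v p : H}

/-- The integrability statements following from the dissipation estimate. -/
theorem integrable_parts (h : EnergySetting f g ψ γ lam β x Lg Lψ T)
    (hf : IsProperConvexLsc f) {μ : ℝ} (hμ0 : 0 ≤ μ)
    (hμ : ∀ x y u v : H, u ∈ subdiff f x → v ∈ subdiff f y → μ * ‖x - y‖ ^ 2 ≤ ⟪x - y, u - v⟫_ℝ)
    (hv : v ∈ subdiff f u) (hp : p ∈ normalCone (argmin ψ) u)
    (h0 : v + gradient g u + p = 0) :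
    IntegrableOn (fun t => ‖acceleration x t‖ ^ 2) (Ici T) ∧
    IntegrableOn (fun t => ‖velocity x t‖ ^ 2) (Ici T) ∧
    IntegrableOn (fun t => lam t * β t * ⟪gradient ψ (x t), x t - u⟫_ℝ) (Ici T) ∧
    IntegrableOn (fun t => μ * (lam t * ‖dampedAcceleration γ x t + (x t - u)‖ ^ 2)) (Ici T) := by
  have hD := h.dissipation_integrable hf hμ0 hμ hv hp h0
  have hparts : ∀ t, T ≤ t → 0 ≤ lam t * β t * ⟪gradient ψ (x t), x t - u⟫_ℝ ∧
      0 ≤ μ * (lam t * ‖dampedAcceleration γ x t + (x t - u)‖ ^ 2) := fun t ht => by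
    have ht0 := h.T_nonneg.trans ht
    have h1 := h.inner_gradient_nonneg hp.1 (x t)
    rw [real_inner_comm] at h1
    have h2 := h.lam_pos t ht0
    have h3 := h.β_pos t ht0
    constructor <;> positivity
  have hsq : ∀ t, 0 ≤ ‖acceleration x t‖ ^ 2 ∧ 0 ≤ ‖velocity x t‖ ^ 2 := fun t =>
    ⟨sq_nonneg _, sq_nonneg _⟩
  -- All terms of the dissipation are nonnegative and the smallest numerical weight is 1/8, so 8
  -- works for each.
  refine ⟨integrableOn_of_le_dissipation (c := 8) h.T_nonneg (h.acceleration_meas.norm.pow 2) hD ?_,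
    integrableOn_of_le_dissipation (c := 8) h.T_nonneg
      ((h.velocity_ac.continuousOn.aestronglyMeasurable measurableSet_Ici).norm.pow 2) hD ?_,
    integrableOn_of_le_dissipation (c := 8) h.T_nonneg
      ((h.gradient_ψ_inner_cont u).aestronglyMeasurable measurableSet_Ici) hD ?_,
    integrableOn_of_le_dissipation (c := 8) h.T_nonneg ((h.lam_damped_meas u).const_mul μ) hD ?_⟩
  all_goals
    intro t ht
    obtain ⟨h1, h2⟩ := hparts t ht
    obtain ⟨h3, h4⟩ := hsq t
    simp only [dissipation]
    constructor <;> linarith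

theorem integrableOn_velocity_sq (h : EnergySetting f g ψ γ lam β x Lg Lψ T)
    (hf : IsProperConvexLsc f) (hv : v ∈ subdiff f u) (hp : p ∈ normalCone (argmin ψ) u)
    (h0 : v + gradient g u + p = 0) : IntegrableOn (fun t => ‖velocity x t‖ ^ 2) (Ici 0) :=
  h.integrableOn_Ici_zero (h.velocity_ac.continuousOn.norm.pow 2)
    (h.integrable_parts hf le_rfl hf.monotone_subdiff hv hp h0).2.1

theorem integrableOn_gradient_inner (h : EnergySetting f g ψ γ lam β x Lg Lψ T)
    (hf : IsProperConvexLsc f) (hv : v ∈ subdiff f u) (hp : p ∈ normalCone (argmin ψ) u)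
    (h0 : v + gradient g u + p = 0) :
    IntegrableOn (fun t => lam t * β t * ⟪gradient ψ (x t), x t - u⟫_ℝ) (Ici 0) :=
  h.integrableOn_Ici_zero (h.gradient_ψ_inner_cont u)
    (h.integrable_parts hf le_rfl hf.monotone_subdiff hv hp h0).2.2.1

theorem integrableOn_gradient_sq (h : EnergySetting f g ψ γ lam β x Lg Lψ T)
    (hf : IsProperConvexLsc f) (hv : v ∈ subdiff f u) (hp : p ∈ normalCone (argmin ψ) u)
    (h0 : v + gradient g u + p = 0) :
    IntegrableOn (fun t => lam t * β t * ‖gradient ψ (x t)‖ ^ 2) (Ici 0) := by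
  refine Integrable.mono' ((h.integrableOn_gradient_inner hf hv hp h0).const_mul Lψ)
    (((h.lam_cont.mul h.β_cont).mul
      ((h.gradient_ψ_cont.comp_continuousOn h.x_ac.continuousOn).norm.pow 2)).aestronglyMeasurable
        measurableSet_Ici) ?_
  filter_upwards [self_mem_ae_restrict measurableSet_Ici] with t ht
  have h1 := mul_pos (h.lam_pos t ht) (h.β_pos t ht)
  have h2 := h.cocoercive_ψ (x t) u
  rw [h.gradient_ψ_eq u hp.1, sub_zero, real_inner_comm] at h2
  rw [Real.norm_of_nonneg (by positivity)]
  have h3 := mul_le_mul_of_nonneg_left h2 h1.le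
  linarith

/-- Beyond T the dissipation controls x''. On [0, T] the crude bound on x'' + γ x' dominates ‖x''‖²
by a continuous function. -/
theorem integrableOn_acceleration_sq (h : EnergySetting f g ψ γ lam β x Lg Lψ T)
    (hf : IsProperConvexLsc f) (hv : v ∈ subdiff f u) (hp : p ∈ normalCone (argmin ψ) u)
    (h0 : v + gradient g u + p = 0) :
    IntegrableOn (fun t => ‖acceleration x t‖ ^ 2) (Ici 0) := by
  rw [← Icc_union_Ici_eq_Ici h.T_nonneg]
  refine IntegrableOn.union ?_ (h.integrable_parts hf le_rfl hf.monotone_subdiff hv hp h0).1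
  have hsub : Icc 0 T ⊆ Ici 0 := Icc_subset_Ici_self
  have hxu := h.x_ac.continuousOn.sub (continuousOn_const (c := u))
  have hb := h.gradient_ψ_cont.comp_continuousOn h.x_ac.continuousOn
  have hd := (h.gradient_g_cont.comp_continuousOn h.x_ac.continuousOn).sub
    (continuousOn_const (c := gradient g u))
  have hcont : ContinuousOn (fun t => 2 * ((‖x t - u‖ + lam t * β t * ‖gradient ψ (x t)‖
      + lam t * ‖gradient g (x t) - gradient g u‖ + lam t * ‖gradient g u + v‖) ^ 2
      + 2 * (lam t * ‖x t - u‖ * ‖gradient g u + v‖)) + 2 * ‖γ t • velocity x t‖ ^ 2)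
      (Icc 0 T) :=
    ContinuousOn.mono (((((((hxu.norm.add ((h.lam_cont.mul h.β_cont).mul hb.norm)).add
      (h.lam_cont.mul hd.norm)).add (h.lam_cont.mul continuousOn_const)).pow 2).add
      (((h.lam_cont.mul hxu.norm).mul continuousOn_const).const_mul 2)).const_mul 2).add
      (((h.γ_ac.continuousOn.smul h.velocity_ac.continuousOn).norm.pow 2).const_mul 2)) hsub
  refine Integrable.mono' hcont.integrableOn_Icc
    ((h.acceleration_meas.norm.pow 2).mono_set hsub) ?_
  filter_upwards [ae_restrict_of_ae_restrict_of_subset hsub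
    (h.ae_inner_subgradient hf.monotone_subdiff hv), self_mem_ae_restrict measurableSet_Icc]
    with t h1 ht
  rw [zero_mul] at h1
  have h2 := sq_norm_le_of_inner (h.lam_pos t ht.1) (h.β_pos t ht.1) h1
    (h.inner_gradient_nonneg hp.1 _) (h.inner_gradient_sub_nonneg _ _)
  rw [Real.norm_of_nonneg (by positivity)]
  have h3 : acceleration x t = dampedAcceleration γ x t - γ t • velocity x t := by
    rw [dampedAcceleration, add_sub_cancel_right]
  have h4 : ‖acceleration x t‖ ≤ ‖dampedAcceleration γ x t‖ + ‖γ t • velocity x t‖ := by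
    rw [h3]; exact norm_sub_le _ _
  have h5 := pow_le_pow_left₀ (norm_nonneg _) h4 2
  nlinarith [sq_nonneg (‖dampedAcceleration γ x t‖ - ‖γ t • velocity x t‖)]

/-- The derivative of ‖x'‖² is 2⟪x', x''⟫, bounded by ‖x'‖² + ‖x''‖²; both ‖x'‖² and its derivative
are thus integrable. -/
theorem velocity_tendsto_zero (h : EnergySetting f g ψ γ lam β x Lg Lψ T)
    (hf : IsProperConvexLsc f) (hv : v ∈ subdiff f u) (hp : p ∈ normalCone (argmin ψ) u)
    (h0 : v + gradient g u + p = 0) : Tendsto (velocity x) atTop (𝓝 0) := by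
  have hvi := h.integrableOn_velocity_sq hf hv hp h0
  have hai := h.integrableOn_acceleration_sq hf hv hp h0
  have hd : IntegrableOn (deriv fun t => ‖velocity x t‖ ^ 2) (Ici 0) := by
    refine Integrable.mono' (hvi.add hai) (stronglyMeasurable_deriv _).aestronglyMeasurable ?_
    filter_upwards [h.velocity_deriv] with t ht
    rw [ht.norm_sq.deriv, Real.norm_eq_abs, abs_mul, abs_two]
    have h1 := abs_real_inner_le_norm (velocity x t) (acceleration x t)
    simp only [Pi.add_apply]
    nlinarith [sq_nonneg (‖velocity x t‖ - ‖acceleration x t‖)]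
  have h1 := (h.velocity_ac.norm_sq.tendsto_zero hvi hd).sqrt
  rw [Real.sqrt_zero] at h1
  refine tendsto_zero_iff_norm_tendsto_zero.2 (h1.congr fun t => ?_)
  exact Real.sqrt_sq (norm_nonneg _)

theorem inner_velocity_tendsto_zero (h : EnergySetting f g ψ γ lam β x Lg Lψ T)
    (hf : IsProperConvexLsc f) (hv : v ∈ subdiff f u) (hp : p ∈ normalCone (argmin ψ) u)
    (h0 : v + gradient g u + p = 0) :
    Tendsto (fun t => ⟪x t - u, velocity x t⟫_ℝ) atTop (𝓝 0) := by
  obtain ⟨K, hK⟩ := h.exists_bound hf hv hp h0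
  have h1 := (h.velocity_tendsto_zero hf hv hp h0).norm.const_mul (K + ‖u‖)
  rw [norm_zero, mul_zero] at h1
  refine squeeze_zero_norm' ?_ h1
  filter_upwards [eventually_ge_atTop 0] with t ht
  have h4 : ‖x t - u‖ ≤ K + ‖u‖ := (norm_sub_le _ _).trans (by linarith [(hK t ht).1])
  exact (norm_inner_le_norm _ _).trans (mul_le_mul_of_nonneg_right h4 (norm_nonneg _))

/-- The energy converges and its terms containing x' vanish in the limit. What remains is γ‖x - u‖²
/ 2, and γ decreases to a limit at least √2. -/
theorem exists_tendsto_norm_sub (h : EnergySetting f g ψ γ lam β x Lg Lψ T)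
    (hf : IsProperConvexLsc f) (hv : v ∈ subdiff f u) (hp : p ∈ normalCone (argmin ψ) u)
    (h0 : v + gradient g u + p = 0) : ∃ l, Tendsto (fun t => ‖x t - u‖) atTop (𝓝 l) := by
  obtain ⟨K, hK⟩ := h.exists_bound hf hv hp h0
  obtain ⟨E, hE⟩ := (h.energy_ac u).exists_tendsto_of_deriv_le h.T_nonneg
    (fun t ht => h.energy_bound hK u (h.T_nonneg.trans ht)) (h.remainder_integrable (v := v) hp) (by
      filter_upwards [h.ae_deriv_energy_add_le hf.monotone_subdiff hv hp,
        self_mem_ae_restrict measurableSet_Ici] with t h1 ht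
      have := h.dissipation_nonneg le_rfl hp.1 (h.T_nonneg.trans ht)
      rw [h0, inner_zero_right, mul_zero] at h1
      linarith)
  obtain ⟨G, hG⟩ := exists_tendsto_of_antitoneOn h.γ_antitone (fun t ht => h.γ_ge t ht)
  have hG0 : 0 < G := (Real.sqrt_pos.2 two_pos).trans_le
    (ge_of_tendsto hG ((eventually_ge_atTop 0).mono fun t ht => h.γ_ge t ht))
  have hv2 := (hG.mul ((h.velocity_tendsto_zero hf hv hp h0).norm.pow 2)).const_mul (7 / 12)
  have h1 := ((hE.sub (h.inner_velocity_tendsto_zero hf hv hp h0)).sub hv2).div hG hG0.ne'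
  have h2 := (h1.const_mul 2).sqrt
  refine ⟨_, h2.congr' ?_⟩
  filter_upwards [eventually_ge_atTop 0] with t ht
  have hγ := h.γ_pos ht
  have h3 : 2 * ((energy γ x u t - ⟪x t - u, velocity x t⟫_ℝ
      - 7 / 12 * (γ t * ‖velocity x t‖ ^ 2)) / γ t) = ‖x t - u‖ ^ 2 := by
    unfold energy
    field_simp
    ring
  rw [Pi.div_apply, h3, Real.sqrt_sq (norm_nonneg _)]

/-- Strong convergence when the subdifferential is strongly monotone. -/
theorem tendsto_of_strongly_monotone (h : EnergySetting f g ψ γ lam β x Lg Lψ T)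
    (hf : IsProperConvexLsc f) {μ : ℝ} (hμ0 : 0 < μ)
    (hμ : ∀ x y u v : H, u ∈ subdiff f x → v ∈ subdiff f y → μ * ‖x - y‖ ^ 2 ≤ ⟪x - y, u - v⟫_ℝ)
    (hlam : ¬ IntegrableOn lam (Ici 0))
    (hv : v ∈ subdiff f u) (hp : p ∈ normalCone (argmin ψ) u)
    (h0 : v + gradient g u + p = 0) : Tendsto x atTop (𝓝 u) := by
  obtain ⟨hai, hvi, -, hsi⟩ := h.integrable_parts hf hμ0.le hμ hv hp h0
  have hsi' : IntegrableOn (fun t => lam t * ‖dampedAcceleration γ x t + (x t - u)‖ ^ 2)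
      (Ici T) := by
    refine (hsi.const_mul μ⁻¹).congr (Eventually.of_forall fun t => ?_)
    simp only
    field_simp
  have hγ0 := h.γ_pos le_rfl
  -- Write x - u as (e + x - u) - e. The part λ‖e‖² is integrable because λ ≤ 1 / (6 Lg) beyond T
  -- and ‖e‖ ≤ ‖x''‖ + γ(0)‖x'‖, γ being nonincreasing.
  have hxi : IntegrableOn (fun t => lam t * ‖x t - u‖ ^ 2) (Ici T) := by
    refine Integrable.mono' ((hsi'.const_mul 2).add
      ((hai.add (hvi.const_mul (γ 0 ^ 2))).const_mul (2 * (1 / (3 * Lg)))))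
      ((h.lam_cont.mul ((h.x_ac.sub_const u).continuousOn.norm.pow 2)).mono
        (Ici_subset_Ici.2 h.T_nonneg) |>.aestronglyMeasurable measurableSet_Ici) ?_
    filter_upwards [self_mem_ae_restrict measurableSet_Ici] with t ht
    have ht0 : 0 ≤ t := h.T_nonneg.trans ht
    have hl := h.lam_pos t ht0
    have hLg := h.Lg_pos
    rw [Real.norm_of_nonneg (by positivity)]
    have h1 : ‖x t - u‖ ≤ ‖dampedAcceleration γ x t + (x t - u)‖ + ‖dampedAcceleration γ x t‖ := by
      have := norm_sub_le (dampedAcceleration γ x t + (x t - u)) (dampedAcceleration γ x t)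
      rwa [add_sub_cancel_left] at this
    have h2 := pow_le_pow_left₀ (norm_nonneg _) h1 2
    have h3 : ‖dampedAcceleration γ x t‖ ≤ ‖acceleration x t‖ + γ 0 * ‖velocity x t‖ := by
      refine (norm_add_le _ _).trans ?_
      rw [norm_smul, Real.norm_of_nonneg (h.γ_pos ht0).le]
      gcongr
      exact h.γ_antitone self_mem_Ici ht0 ht0
    have h4 := pow_le_pow_left₀ (norm_nonneg _) h3 2
    have h5 : lam t ≤ 1 / (3 * Lg) / 2 := by
      rw [div_div, le_div_iff₀ (by positivity)]
      linarith [h.step_g t ht]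
    have h6 : ‖dampedAcceleration γ x t‖ ^ 2 ≤
        2 * (‖acceleration x t‖ ^ 2 + γ 0 ^ 2 * ‖velocity x t‖ ^ 2) := by
      nlinarith [sq_nonneg (‖acceleration x t‖ - γ 0 * ‖velocity x t‖)]
    have h7 : ‖x t - u‖ ^ 2 ≤ 2 * ‖dampedAcceleration γ x t + (x t - u)‖ ^ 2
        + 2 * ‖dampedAcceleration γ x t‖ ^ 2 := by
      nlinarith [sq_nonneg (‖dampedAcceleration γ x t + (x t - u)‖ - ‖dampedAcceleration γ x t‖)]
    have h8 := mul_le_mul_of_nonneg_left h7 hl.le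
    have h9 : lam t * ‖dampedAcceleration γ x t‖ ^ 2 ≤ 1 / (3 * Lg) / 2 *
        (2 * (‖acceleration x t‖ ^ 2 + γ 0 ^ 2 * ‖velocity x t‖ ^ 2)) :=
      mul_le_mul h5 h6 (by positivity) (by positivity)
    simp only [Pi.add_apply]
    linarith
  obtain ⟨l, hl⟩ := h.exists_tendsto_norm_sub hf hv hp h0
  have hl2 := tendsto_zero_of_integrableOn_mul h.lam_cont (fun t ht => (h.lam_pos t ht).le) hlam
    (hl.pow 2) ⟨T, hxi⟩
  rw [pow_eq_zero_iff two_ne_zero] at hl2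
  rw [hl2] at hl
  exact tendsto_iff_norm_sub_tendsto_zero.2 hl

end Zero

/-! ### Weak convergence of the ergodic averages. -/

theorem inner_ergodicAverage (h : EnergySetting f g ψ γ lam β x Lg Lψ T) (w : H) {t : ℝ}
    (ht : 0 ≤ t) : ⟪ergodicAverage lam x t, w⟫_ℝ =
      (∫ s in (0 : ℝ)..t, lam s)⁻¹ * ∫ s in (0 : ℝ)..t, lam s * ⟪x s, w⟫_ℝ := by
  rw [ergodicAverage, real_inner_smul_left, real_inner_comm,
    intervalIntegral.integral_of_le ht, intervalIntegral.integral_of_le ht,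
    intervalIntegral.integral_of_le ht]
  congr 1
  have hi : IntegrableOn (fun s => lam s • x s) (Ioc 0 t) :=
    (intervalIntegrable_iff_integrableOn_Ioc_of_le ht).1 (intervalIntegrable_of_continuousOn_Ici
      (h.lam_cont.smul h.x_ac.continuousOn) le_rfl ht)
  rw [← integral_inner hi w]
  congr 1
  ext s
  rw [inner_smul_right, real_inner_comm]

theorem norm_ergodicAverage_le (h : EnergySetting f g ψ γ lam β x Lg Lψ T) {K : ℝ}
    (hK : ∀ t, 0 ≤ t → ‖x t‖ ≤ K) {t : ℝ} (ht : 0 ≤ t) (hW : 0 < ∫ s in (0 : ℝ)..t, lam s) :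
    ‖ergodicAverage lam x t‖ ≤ K := by
  rw [ergodicAverage, norm_smul, norm_inv, Real.norm_of_nonneg hW.le, inv_mul_le_iff₀ hW,
    ← intervalIntegral.integral_mul_const]
  refine intervalIntegral.norm_integral_le_of_norm_le ht (Eventually.of_forall fun s hs => ?_)
    (intervalIntegrable_of_continuousOn_Ici (h.lam_cont.mul continuousOn_const) le_rfl ht)
  rw [norm_smul, Real.norm_of_nonneg (h.lam_pos s hs.1.le).le]
  exact mul_le_mul_of_nonneg_left (hK s hs.1.le) (h.lam_pos s hs.1.le).le

/-- Weak cluster points of the ergodic averages are monotonically related to the graph of the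
optimality operator. -/
theorem inner_nonneg_of_cluster (h : EnergySetting f g ψ γ lam β x Lg Lψ T)
    (hf : IsProperConvexLsc f) {K : ℝ} (hK : ∀ t, 0 ≤ t → ‖x t‖ ≤ K ∧ ‖velocity x t‖ ≤ K)
    (hlam : ¬ IntegrableOn lam (Ici 0)) {U : Ultrafilter ℝ} (hU : ↑U ≤ (atTop : Filter ℝ)) {z : H}
    (hz : ∀ w, Tendsto (fun t => ⟪ergodicAverage lam x t, w⟫_ℝ) U (𝓝 ⟪z, w⟫_ℝ))
    {u v p : H} (hv : v ∈ subdiff f u) (hp : p ∈ normalCone (argmin ψ) u) :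
    0 ≤ ⟪u - z, v + gradient g u + p⟫_ℝ := by
  set w := v + gradient g u + p with hw
  have hW := tendsto_integral_atTop_of_not_integrableOn h.lam_cont
    (fun t ht => (h.lam_pos t ht).le) hlam
  have hSc : ContinuousOn (fun s => lam s * ⟪x s - u, w⟫_ℝ) (Ici 0) :=
    h.lam_cont.mul ((h.x_ac.sub_const u).continuousOn.inner continuousOn_const)
  set M := (∫ s in (0 : ℝ)..T, lam s * ⟪x s - u, w⟫_ℝ) + (energy γ x u T
    + ∫ r in Ici T, abs (remainder g ψ lam β x u v p r)) + (K + ‖u‖) * K with hM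
  -- The energy is bounded below, so integrating the energy inequality bounds this integral
  -- uniformly in t; w need not vanish.
  have hle : ∀ t, T ≤ t → ∫ s in (0 : ℝ)..t, lam s * ⟪x s - u, w⟫_ℝ ≤ M := fun t ht => by
    have ht0 := h.T_nonneg.trans ht
    have h1 := (h.energy_ac u).integral_add_le h.T_nonneg ht (h.remainder_integrable (v := v) hp)
      (intervalIntegrable_of_continuousOn_Ici hSc h.T_nonneg ht0) (by
        filter_upwards [h.ae_deriv_energy_add_le hf.monotone_subdiff hv hp,
          self_mem_ae_restrict measurableSet_Ici] with t h1 ht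
        have := h.dissipation_nonneg le_rfl hp.1 (h.T_nonneg.trans ht)
        linarith)
    have h2 := intervalIntegral.integral_add_adjacent_intervals
      (intervalIntegrable_of_continuousOn_Ici hSc le_rfl h.T_nonneg)
      (intervalIntegrable_of_continuousOn_Ici hSc h.T_nonneg ht0)
    have h3 := h.energy_bound hK u ht0
    linarith
  have hlim0 : Tendsto (fun t => (∫ s in (0 : ℝ)..t, lam s)⁻¹ * M) U (𝓝 0) := by
    have := (hW.inv_tendsto_atTop.mul_const M).mono_left hU
    rwa [zero_mul] at this
  have h4 : ⟪z, w⟫_ℝ - ⟪u, w⟫_ℝ ≤ 0 := by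
    refine le_of_tendsto_of_tendsto ((hz w).sub_const ⟪u, w⟫_ℝ) hlim0 ?_
    filter_upwards [hU (eventually_ge_atTop T), hU (hW.eventually_gt_atTop 0)] with t ht hWt
    have ht0 := h.T_nonneg.trans ht
    have h5 : ∫ s in (0 : ℝ)..t, lam s * ⟪x s - u, w⟫_ℝ =
        (∫ s in (0 : ℝ)..t, lam s * ⟪x s, w⟫_ℝ) - (∫ s in (0 : ℝ)..t, lam s) * ⟪u, w⟫_ℝ := by
      rw [← intervalIntegral.integral_mul_const, ← intervalIntegral.integral_sub]
      · simp_rw [inner_sub_left, mul_sub]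
      · exact intervalIntegrable_of_continuousOn_Ici
          (h.lam_cont.mul (h.x_ac.continuousOn.inner continuousOn_const)) le_rfl ht0
      · exact intervalIntegrable_of_continuousOn_Ici
          (h.lam_cont.mul continuousOn_const) le_rfl ht0
    have h6 := mul_le_mul_of_nonneg_left (hle t ht) (inv_pos.2 hWt).le
    rw [h5, mul_sub, inv_mul_cancel_left₀ hWt.ne'] at h6
    rwa [h.inner_ergodicAverage w ht0]
  rw [inner_sub_left]
  linarith

/-- Weak ergodic convergence. -/
theorem exists_tendsto_ergodicAverage (h : EnergySetting f g ψ γ lam β x Lg Lψ T)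
    (hf : IsProperConvexLsc f) (hlam : ¬ IntegrableOn lam (Ici 0)) {Z : Set H} (hZne : Z.Nonempty)
    (hZ : ∀ u ∈ Z, ∃ v ∈ subdiff f u, ∃ p ∈ normalCone (argmin ψ) u, v + gradient g u + p = 0)
    (hmem : ∀ z, (∀ u v p : H, v ∈ subdiff f u → p ∈ normalCone (argmin ψ) u →
      0 ≤ ⟪u - z, v + gradient g u + p⟫_ℝ) → z ∈ Z) :
    ∃ z ∈ Z, Tendsto (fun t => toWeakSpace ℝ H (ergodicAverage lam x t)) atTop
      (𝓝 (toWeakSpace ℝ H z)) := by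
  obtain ⟨u, hu⟩ := hZne
  obtain ⟨v, hv, p, hp, h0⟩ := hZ u hu
  obtain ⟨K, hK⟩ := h.exists_bound hf hv hp h0
  have hW := tendsto_integral_atTop_of_not_integrableOn h.lam_cont
    (fun t ht => (h.lam_pos t ht).le) hlam
  refine exists_tendsto_toWeakSpace (K := K) ?_ ?_ ?_
  · filter_upwards [eventually_ge_atTop 0, hW.eventually_gt_atTop 0] with t ht hWt
    exact h.norm_ergodicAverage_le (fun t ht => (hK t ht).1) ht hWt
  · intro U hU z hz
    exact hmem z fun u v p hv hp => h.inner_nonneg_of_cluster hf hK hlam hU hz hv hp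
  · intro z₁ hz₁ z₂ hz₂
    obtain ⟨v₁, hv₁, p₁, hp₁, h₁⟩ := hZ z₁ hz₁
    obtain ⟨v₂, hv₂, p₂, hp₂, h₂⟩ := hZ z₂ hz₂
    obtain ⟨l₁, hl₁⟩ := h.exists_tendsto_norm_sub hf hv₁ hp₁ h₁
    obtain ⟨l₂, hl₂⟩ := h.exists_tendsto_norm_sub hf hv₂ hp₂ h₂
    -- The distances to z₁ and z₂ converge, hence so does ⟪x(t), z₁ - z₂⟫, and its weighted averages
    -- inherit the limit.
    have hlim : Tendsto (fun t => ⟪x t, z₁ - z₂⟫_ℝ) atTop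
        (𝓝 (1 / 2 * (l₂ ^ 2 - l₁ ^ 2 + (‖z₁‖ ^ 2 - ‖z₂‖ ^ 2)))) := by
      refine ((((hl₂.pow 2).sub (hl₁.pow 2)).add_const _).const_mul (1 / 2)).congr fun t => ?_
      rw [norm_sub_sq_real, norm_sub_sq_real, inner_sub_right]
      ring
    refine ⟨_, (tendsto_weighted_average h.lam_cont (fun t ht => (h.lam_pos t ht).le) hlam
      (h.x_ac.continuousOn.inner continuousOn_const) hlim).congr' ?_⟩
    filter_upwards [eventually_ge_atTop 0] with t ht
    exact (h.inner_ergodicAverage _ ht).symm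

end EnergySetting

end Bilevel

namespace Bilevel

/-! ### The Fenchel condition and verification of the energy setting. -/

section Setting

variable {H : Type*} [NormedAddCommGroup H] [InnerProductSpace ℝ H]

/-- Fenchel's inequality bounds ψ* from below, and normality of p at u gives σ_C(p) ≤ ⟪u, p⟫. -/
theorem coe_le_conjugate_sub_supportFun {ψ : H → ℝ} {C : Set H} {u p : H}
    (hp : ∀ y ∈ C, ⟪y - u, p⟫_ℝ ≤ 0) (y : H) :
    ((⟪y - u, p⟫_ℝ - ψ y : ℝ) : EReal) ≤ conjugate ψ p - supportFun C p := by
  have h1 : ((⟪p, y⟫_ℝ - ψ y : ℝ) : EReal) ≤ conjugate ψ p :=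
    le_iSup (fun y => ((⟪p, y⟫_ℝ - ψ y : ℝ) : EReal)) y
  have h2 : supportFun C p ≤ ((⟪u, p⟫_ℝ : ℝ) : EReal) := by
    refine iSup₂_le fun z hz => ?_
    have := hp z hz
    rw [inner_sub_left] at this
    exact_mod_cast (by linarith : ⟪z, p⟫_ℝ ≤ ⟪u, p⟫_ℝ)
  refine le_trans (le_of_eq ?_) (EReal.sub_le_sub h1 h2)
  rw [inner_sub_left, real_inner_comm]
  norm_cast
  ring

/-- The condition on the Fenchel conjugate makes the penalty gap integrable along every continuous
curve. -/
theorem integrableOn_penalty_gap {ψ : H → ℝ} {lam β : ℝ → ℝ} {x : ℝ → H}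
    (hψ : Continuous ψ) (hlam : ∀ t, 0 ≤ t → 0 < lam t) (hβ : ∀ t, 0 ≤ t → 0 < β t)
    (hlamc : ContinuousOn lam (Ici 0)) (hβc : ContinuousOn β (Ici 0))
    (hx : ContinuousOn x (Ici 0))
    (hH : ∀ p ∈ ran (normalCone (argmin ψ)), ∫⁻ t in Ici (0 : ℝ), ENNReal.ofReal (lam t * β t) *
      (conjugate ψ ((β t)⁻¹ • p) - supportFun (argmin ψ) ((β t)⁻¹ • p)).toENNReal < ⊤)
    {u p : H} (hp : p ∈ normalCone (argmin ψ) u) :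
    IntegrableOn (fun t => lam t * max 0 (⟪x t - u, p⟫_ℝ - 1 / 8 * (β t * ψ (x t))))
      (Ici 0) := by
  have hcont : ContinuousOn
      (fun t => lam t * max 0 (⟪x t - u, p⟫_ℝ - 1 / 8 * (β t * ψ (x t)))) (Ici 0) :=
    hlamc.mul (ContinuousOn.sup continuousOn_const
      (((hx.sub continuousOn_const).inner continuousOn_const).sub
        (continuousOn_const.mul (hβc.mul (hψ.comp_continuousOn hx)))))
  refine ⟨hcont.aestronglyMeasurable measurableSet_Ici, ?_⟩
  rw [hasFiniteIntegral_iff_ofReal (by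
    filter_upwards [self_mem_ae_restrict measurableSet_Ici] with t ht
    exact mul_nonneg (hlam t ht).le (le_max_left _ _))]
  -- Normal cones are cones, so the integral condition applies to 8p; this compensates the factor
  -- 1/8 before βψ.
  have h8 : (8 : ℝ) • p ∈ ran (normalCone (argmin ψ)) := ⟨u, hp.1, fun y hy => by
    rw [inner_smul_right]
    linarith [hp.2 y hy]⟩
  refine lt_of_le_of_lt (setLIntegral_mono' measurableSet_Ici fun t ht => ?_) (hH _ h8)
  have hl := hlam t ht
  have hb := hβ t ht
  set q := (β t)⁻¹ • (8 : ℝ) • p with hq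
  have hqC : ∀ y ∈ argmin ψ, ⟪y - u, q⟫_ℝ ≤ 0 := fun y hy => by
    rw [hq, inner_smul_right, inner_smul_right]
    exact mul_nonpos_of_nonneg_of_nonpos (inv_pos.2 hb).le (by linarith [hp.2 y hy])
  have h1 := EReal.toENNReal_le_toENNReal (coe_le_conjugate_sub_supportFun (ψ := ψ) hqC (x t))
  rw [EReal.toENNReal_of_ne_top (EReal.coe_ne_top _), EReal.toReal_coe] at h1
  refine le_trans ?_ (mul_le_mul_right h1 _)
  rw [← ENNReal.ofReal_mul (by positivity)]
  have h2 : ⟪x t - u, p⟫_ℝ - 1 / 8 * (β t * ψ (x t)) =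
      1 / 8 * (β t * (⟪x t - u, q⟫_ℝ - ψ (x t))) := by
    rw [hq, inner_smul_right, inner_smul_right]
    field_simp
  rcases le_total (⟪x t - u, q⟫_ℝ - ψ (x t)) 0 with h3 | h3
  · have h4 : ⟪x t - u, p⟫_ℝ - 1 / 8 * (β t * ψ (x t)) ≤ 0 := by
      rw [h2]
      have := mul_nonpos_of_nonneg_of_nonpos hb.le h3
      linarith
    rw [max_eq_left h4, mul_zero, ENNReal.ofReal_zero]
    exact zero_le
  · refine ENNReal.ofReal_le_ofReal ?_
    have h4 := mul_nonneg hb.le h3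
    rw [h2, max_eq_right (by linarith), mul_assoc]
    exact mul_le_mul_of_nonneg_left (by linarith) hl.le

/-- Some s ≥ t satisfies the bound, since [t, ∞) has positive measure; monotonicity carries the
bound back from s to t. -/
theorem le_of_ae_le_of_antitoneOn {γ : ℝ → ℝ} {c : ℝ} (hγ : AntitoneOn γ (Ici 0))
    (h : ∀ᵐ t ∂(volume.restrict (Ici (0 : ℝ))), c ≤ γ t) {t : ℝ} (ht : 0 ≤ t) : c ≤ γ t := by
  have h1 : ∀ᵐ s ∂(volume.restrict (Ici t)), c ≤ γ s :=
    ae_restrict_of_ae_restrict_of_subset (Ici_subset_Ici.2 ht) h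
  have hne : volume.restrict (Ici t) ≠ 0 := by
    rw [Ne, Measure.restrict_eq_zero]
    simp
  have : (ae (volume.restrict (Ici t))).NeBot := ae_neBot.2 hne
  obtain ⟨s, hs, hst⟩ := (h1.and (self_mem_ae_restrict measurableSet_Ici)).exists
  exact hs.trans (hγ ht (ht.trans hst) hst)

/-- The constant Lg + 1 makes the cocoercivity constant of ∇g positive even when Lg = 0. The time T
comes from λ → 0 and the limsup condition on λβ. -/
theorem exists_energySetting [CompleteSpace H] {f : H → EReal} {g ψ : H → ℝ} {Lg Lψ : ℝ≥0}
    (hf : IsProperConvexLsc f)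
    (hg_convex : ConvexOn ℝ univ g) (hg_diff : Differentiable ℝ g)
    (hg_lip : LipschitzWith Lg (gradient g))
    (hψ_convex : ConvexOn ℝ univ ψ) (hψ_diff : Differentiable ℝ ψ)
    (hLψ : 0 < Lψ) (hψ_lip : LipschitzWith Lψ (gradient ψ))
    (hψ_min : IsLeast (range ψ) 0) {γ lam β : ℝ → ℝ}
    (hlam_pos : ∀ t, 0 ≤ t → 0 < lam t) (hβ_pos : ∀ t, 0 ≤ t → 0 < β t)
    (hlam_cont : ContinuousOn lam (Ici 0)) (hβ_cont : ContinuousOn β (Ici 0))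
    (hlam_L2 : MemLp lam 2 (volume.restrict (Ici (0 : ℝ))))
    (hlam_lim : Tendsto lam atTop (𝓝 0))
    (hH : ∀ p ∈ ran (normalCone (argmin ψ)), ∫⁻ t in Ici (0 : ℝ), ENNReal.ofReal (lam t * β t) *
      (conjugate ψ ((β t)⁻¹ • p) - supportFun (argmin ψ) ((β t)⁻¹ • p)).toENNReal < ⊤)
    (hlimsup : limsup (fun t : ℝ => ((lam t * β t : ℝ) : EReal)) atTop
      < ((1 / (Lψ : ℝ) : ℝ) : EReal))
    (hγ_ac : LocallyAC γ)
    (hγ : ∀ᵐ t ∂(volume.restrict (Ici (0 : ℝ))), √2 ≤ γ t ∧ deriv γ t ≤ 0)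
    {u₀ v₀ : H} {x : ℝ → H} (hx : IsStrongGlobalSolution f g ψ γ lam β u₀ v₀ x) :
    ∃ T, EnergySetting f g ψ γ lam β x (Lg + 1 : ℝ≥0) Lψ T := by
  have hLψ' : (0 : ℝ) < Lψ := hLψ
  have hLg' : (0 : ℝ) < (Lg + 1 : ℝ≥0) := by positivity
  have hev1 : ∀ᶠ t in atTop, lam t * β t * Lψ ≤ 1 := by
    filter_upwards [eventually_lt_of_limsup_lt hlimsup] with t ht
    have h1 := EReal.coe_lt_coe_iff.1 ht
    rw [lt_div_iff₀ hLψ'] at h1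
    exact h1.le
  have hev2 : ∀ᶠ t in atTop, lam t * (Lg + 1 : ℝ≥0) ≤ 1 / 6 := by
    have h1 := hlam_lim.mul_const ((Lg + 1 : ℝ≥0) : ℝ)
    rw [zero_mul] at h1
    filter_upwards [h1.eventually (Iio_mem_nhds (show (0 : ℝ) < 1 / 6 by norm_num))] with t ht
    exact le_of_lt ht
  obtain ⟨T, hT⟩ := eventually_atTop.1 ((hev1.and hev2).and (eventually_ge_atTop 0))
  have hcrit : ∀ u ∈ argmin ψ, gradient ψ u = 0 := fun u hu => by
    rw [← zer_gradient_eq_argmin hψ_convex hψ_diff] at hu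
    exact (mem_singleton_iff.1 hu).symm
  have hzero : ∀ u ∈ argmin ψ, ψ u = 0 := fun u hu => by
    obtain ⟨⟨y, hy⟩, hlb⟩ := hψ_min
    exact le_antisymm (hy ▸ hu y) (hlb ⟨u, rfl⟩)
  have hxc := hx.ac.continuousOn
  have hanti := hγ_ac.antitoneOn (hγ.mono fun t h => h.2)
  refine ⟨T, ?_⟩
  exact
    { T_nonneg := (hT T le_rfl).2
      lam_pos := hlam_pos
      β_pos := hβ_pos
      lam_cont := hlam_cont
      β_cont := hβ_cont
      γ_ac := hγ_ac
      γ_deriv := hγ.mono fun t h => h.2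
      γ_ge := fun t ht => le_of_ae_le_of_antitoneOn hanti (hγ.mono fun t h => h.1) ht
      gradient_g_cont := hg_lip.continuous
      gradient_ψ_cont := hψ_lip.continuous
      cocoercive_g := cocoercive_gradient (by positivity) hg_convex hg_diff
        (hg_lip.weaken le_self_add)
      cocoercive_ψ := cocoercive_gradient hLψ hψ_convex hψ_diff hψ_lip
      Lg_pos := hLg'
      Lψ_pos := hLψ'
      ψ_le := fun y u hu => by
        have h1 := add_inner_gradient_le hψ_convex hψ_diff y u
        rw [hzero u hu, ← neg_sub, inner_neg_right, real_inner_comm] at h1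
        linarith
      gradient_ψ_eq := hcrit
      step_ψ := fun t ht => (hT t ht).1.1
      step_g := fun t ht => (hT t ht).1.2
      lam_sq := (memLp_two_iff_integrable_sq hlam_L2.1).1 hlam_L2
      fenchel := fun u p hp => integrableOn_penalty_gap hψ_diff.continuous hlam_pos hβ_pos
        hlam_cont hβ_cont hxc hH hp
      x_ac := hx.ac
      velocity_ac := hx.ac_velocity
      x_deriv := fun t ht =>
        (hx.differentiable t ht.le).hasDerivWithinAt.hasDerivAt (Ici_mem_nhds ht)
      velocity_deriv := by
        filter_upwards [hx.ode, EnergySetting.ae_pos] with t ht ht0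
        exact ht.1.hasDerivWithinAt.hasDerivAt (Ici_mem_nhds ht0)
      acceleration_meas := aestronglyMeasurable_derivWithin_of_continuousOn
        hx.ac_velocity.continuousOn (hx.ode.mono fun t ht => ht.1)
      subgradient := by
        filter_upwards [hx.ode, self_mem_ae_restrict measurableSet_Ici] with t ht ht0
        have hl := hlam_pos t ht0
        have h1 := smul_sub_mem_subdiff_of_mem_prox hf hl ht.2
        have h2 : (lam t)⁻¹ • (x t - lam t • gradient g (x t) - (lam t * β t) • gradient ψ (x t)
            - (acceleration x t + γ t • velocity x t + x t)) =
            -((lam t)⁻¹ • dampedAcceleration γ x t) - β t • gradient ψ (x t)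
              - gradient g (x t) := by
          have h3 : (lam t)⁻¹ * (lam t * β t) = β t := by field_simp
          rw [dampedAcceleration, smul_sub, smul_sub, smul_sub, smul_smul, smul_smul, h3,
            inv_mul_cancel₀ hl.ne', one_smul, smul_add _ _ (x t)]
          abel
        rw [h2] at h1
        exact h1 }

end Setting

end Bilevel

/-! ### Assembly of the three assertions. -/

theorem corollary3 {H : Type*} [NormedAddCommGroup H] [InnerProductSpace ℝ H] [CompleteSpace H]
    -- the data of the bilevel problem, with the normalization `min ψ = 0`
    (f : H → EReal) (g ψ : H → ℝ) (Lg Lψ : ℝ≥0)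
    (hf : Bilevel.IsProperConvexLsc f)
    (hg_convex : ConvexOn ℝ univ g) (hg_diff : Differentiable ℝ g)
    (hg_lip : LipschitzWith Lg (gradient g))
    (hψ_convex : ConvexOn ℝ univ ψ) (hψ_diff : Differentiable ℝ ψ)
    (hLψ : 0 < Lψ) (hψ_lip : LipschitzWith Lψ (gradient ψ))
    (hψ_min : IsLeast (range ψ) 0)
    -- the parameter functions are positive and continuous on `[0, +∞)`
    (γ lam β : ℝ → ℝ)
    (hγ_pos : ∀ t, 0 ≤ t → 0 < γ t) (hlam_pos : ∀ t, 0 ≤ t → 0 < lam t)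
    (hβ_pos : ∀ t, 0 ≤ t → 0 < β t)
    (hγ_cont : ContinuousOn γ (Ici 0)) (hlam_cont : ContinuousOn lam (Ici 0))
    (hβ_cont : ContinuousOn β (Ici 0))
    -- `∂f + N_C` is maximally monotone and the optimality system is solvable
    (hmax : Bilevel.IsMaximallyMonotone
      (Bilevel.opAdd (Bilevel.subdiff f)
        (Bilevel.normalCone (Bilevel.zer (Bilevel.singleValued (gradient ψ))))))
    (hsolv : (Bilevel.zer (Bilevel.optimalityOp f g ψ)).Nonempty)
    -- `lam ∈ L² \ L¹` and `lam → 0`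
    (hlam_L2 : MemLp lam 2 (volume.restrict (Ici (0 : ℝ))))
    (hlam_L1 : ¬ IntegrableOn lam (Ici (0 : ℝ)))
    (hlam_lim : Tendsto lam atTop (𝓝 0))
    -- the integral condition on the Fenchel conjugate (the integrand is nonnegative)
    (hH : ∀ p ∈ Bilevel.ran (Bilevel.normalCone (Bilevel.argmin ψ)),
      ∫⁻ t in Ici (0 : ℝ), ENNReal.ofReal (lam t * β t) *
        (Bilevel.conjugate ψ ((β t)⁻¹ • p)
          - Bilevel.supportFun (Bilevel.argmin ψ) ((β t)⁻¹ • p)).toENNReal < ⊤)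
    (hlimsup : limsup (fun t : ℝ => ((lam t * β t : ℝ) : EReal)) atTop
      < ((1 / (Lψ : ℝ) : ℝ) : EReal))
    (hγ_ac : Bilevel.LocallyAC γ)
    (hγ : ∀ᵐ t ∂(volume.restrict (Ici (0 : ℝ))), Real.sqrt 2 ≤ γ t ∧ deriv γ t ≤ 0)
    -- the trajectory
    (u₀ v₀ : H) (x : ℝ → H)
    (hx : Bilevel.IsStrongGlobalSolution f g ψ γ lam β u₀ v₀ x) :
    -- (i)
    ((∀ xs ∈ Bilevel.zer (Bilevel.optimalityOp f g ψ),
        (∃ l : ℝ, Tendsto (fun t => ‖x t - xs‖) atTop (𝓝 l)) ∧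
        IntegrableOn (fun t => lam t * β t * ⟪gradient ψ (x t), x t - xs⟫_ℝ) (Ici (0 : ℝ)) ∧
        Tendsto (derivWithin (fun t => 1 / 2 * ‖x t - xs‖ ^ 2) (Ici 0)) atTop (𝓝 0)) ∧
      MemLp (Bilevel.velocity x) 2 (volume.restrict (Ici (0 : ℝ))) ∧
      MemLp (Bilevel.acceleration x) 2 (volume.restrict (Ici (0 : ℝ))) ∧
      IntegrableOn (fun t => lam t * β t * ‖gradient ψ (x t)‖ ^ 2) (Ici (0 : ℝ)) ∧
      Tendsto (Bilevel.velocity x) atTop (𝓝 0)) ∧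
    -- (ii)
    (∃ xbar ∈ Bilevel.zer (Bilevel.optimalityOp f g ψ),
      Bilevel.IsOptimalSolution f g ψ xbar ∧
      Tendsto (fun t => toWeakSpace ℝ H (Bilevel.ergodicAverage lam x t)) atTop
        (𝓝 (toWeakSpace ℝ H xbar))) ∧
    -- (iii)
    (Bilevel.IsStronglyConvex f →
      ∃ xs : H, Bilevel.zer (Bilevel.optimalityOp f g ψ) = {xs} ∧
        {y | Bilevel.IsOptimalSolution f g ψ y} = {xs} ∧
        Tendsto x atTop (𝓝 xs)) := by
  obtain ⟨T, h⟩ := Bilevel.exists_energySetting hf hg_convex hg_diff hg_lip hψ_convex hψ_diff hLψ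
    hψ_lip hψ_min hlam_pos hβ_pos hlam_cont hβ_cont hlam_L2 hlam_lim hH hlimsup hγ_ac hγ hx
  have hC := Bilevel.zer_gradient_eq_argmin hψ_convex hψ_diff
  have hZ : ∀ u ∈ Bilevel.zer (Bilevel.optimalityOp f g ψ), ∃ v ∈ Bilevel.subdiff f u,
      ∃ p ∈ Bilevel.normalCone (Bilevel.argmin ψ) u, v + gradient g u + p = 0 := fun u hu => by
    rw [← hC]
    exact Bilevel.mem_zer_optimalityOp.1 hu
  have hopt := Bilevel.zer_optimalityOp_eq hf hg_convex hg_diff hψ_convex hψ_diff hmax hsolv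
  obtain ⟨xs, hxs⟩ := id hsolv
  obtain ⟨v, hv, p, hp, h0⟩ := hZ xs hxs
  refine ⟨⟨fun u hu => ?_, ?_, ?_, h.integrableOn_gradient_sq hf hv hp h0,
    h.velocity_tendsto_zero hf hv hp h0⟩, ?_, fun hs => ?_⟩
  · obtain ⟨v, hv, p, hp, h0⟩ := hZ u hu
    refine ⟨h.exists_tendsto_norm_sub hf hv hp h0, h.integrableOn_gradient_inner hf hv hp h0,
      (h.inner_velocity_tendsto_zero hf hv hp h0).congr' ?_⟩
    filter_upwards [eventually_gt_atTop 0] with t ht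
    have h1 := (((h.x_deriv t ht).sub_const u).norm_sq.const_mul (1 / 2)).hasDerivWithinAt
      (s := Ici 0)
    rw [h1.derivWithin (uniqueDiffOn_Ici 0 t ht.le)]
    ring
  · exact (memLp_two_iff_integrable_sq_norm
      (h.velocity_ac.continuousOn.aestronglyMeasurable measurableSet_Ici)).2
      (h.integrableOn_velocity_sq hf hv hp h0)
  · exact (memLp_two_iff_integrable_sq_norm h.acceleration_meas).2
      (h.integrableOn_acceleration_sq hf hv hp h0)
  · obtain ⟨z, hz, hlim⟩ := h.exists_tendsto_ergodicAverage hf hlam_L1 hsolv hZ fun z hz =>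
      Bilevel.mem_zer_of_forall_inner_nonneg hf hg_convex hg_diff hψ_convex hψ_diff hmax hsolv
        fun u v p hv hp => hz u v p hv (hC ▸ hp)
    exact ⟨z, hz, hopt.subset hz, hlim⟩
  · obtain ⟨μ, hμ0, hμ⟩ := hs.exists_strongly_monotone hf
    have hlim : ∀ u ∈ Bilevel.zer (Bilevel.optimalityOp f g ψ), Tendsto x atTop (𝓝 u) :=
      fun u hu => by
        obtain ⟨v, hv, p, hp, h0⟩ := hZ u hu
        exact h.tendsto_of_strongly_monotone hf hμ0 hμ hlam_L1 hv hp h0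
    -- The trajectory converges to every zero, so uniqueness of limits leaves only one.
    have hsing : Bilevel.zer (Bilevel.optimalityOp f g ψ) = {xs} :=
      eq_singleton_iff_unique_mem.2
        ⟨hxs, fun y hy => tendsto_nhds_unique (hlim y hy) (hlim xs hxs)⟩
    exact ⟨xs, hsing, hopt ▸ hsing, hlim xs hxs⟩
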